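/- Let $K$ be a number field with ring of integers $\mathcal{O}_K$, put $\widehat K=K\otimes_{\mathbb Q}\mathbb R$, and let $\mathfrak n$ be a nonzero ideal of $\mathcal{O}_K$. A \emph{lattice} is a finitely generated $\mathcal{O}_K$-submodule $L\subset\widehat K^2$ with $\widehat K L=\widehat K^2$ and $\dim_K(KL)=2$. If $L\subseteq M$ are lattices, then $M/L\cong\mathcal{O}_K/\mathfrak a_1\oplus\mathcal{O}_K/\mathfrak a_2$ for unique nonzero ideals $\mathfrak a_1\mid\mathfrak a_2$, and $[M:L]=\mathfrak a_1\mathfrak a_2$. A \emph{modular point for $\Gamma_0(\mathfrak n)$} is a pair $(L,L')$ of lattices with $L\subseteq L'$ and $L'/L\cong\mathcal{O}_K/\mathfrak n$. A \emph{modular point for $\Gamma_1(\mathfrak n)$} is a triple $(L,L',\beta)$ with $(L,L')$ a modular point for $\Gamma_0(\mathfrak n)$ and $\beta\in L'$ such that $L'=L+\mathcal{O}_K\beta$, where $(L,L',\beta_1)$ and $(L,L',\beta_2)$ are identified when $\beta_1-\beta_2\in L$. Let $\mathcal M$ be $\mathcal M_0(\mathfrak n)$ or $\mathcal M_1(\mathfrak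 n)$, the set of modular points for $\Gamma_0(\mathfrak n)$ or for $\Gamma_1(\mathfrak n)$, and let $\mathbb Q\mathcal M$ be the $\mathbb Q$-vector space with basis $\mathcal M$. Define $\mathbb Q$-linear operators on $\mathbb Q\mathcal M$ as follows (for $\mathcal M_0(\mathfrak n)$, omit $\beta$). For every nonzero integral ideal $\mathfrak a$, $$T_{\mathfrak a}(L,L',\beta)=N(\mathfrak a)^{-1}\sum (M,L'+M,\beta),$$ the (finite) sum being over the lattices $M\supseteq L$ with $[M:L]=\mathfrak a$ for which $(M,L'+M,\beta)\in\mathcal M$. For every fractional ideal $\mathfrak a$ coprime to $\mathfrak n$, $$T_{\mathfrak a,\mathfrak a}(L,L',\beta)=N(\mathfrak a)^{-2}(\mathfrak a^{-1}L,\mathfrak a^{-1}L',\beta),$$ where the representative $\beta$ is chosen in $L'\cap\mathfrak a^{-1}L'$ (which is possible, and the result does not depend on the choice). Then, both for $\mathcal M=\mathcal M_0(\mathfrak n)$ and for $\mathcal M=\mathcal M_1(\mathfrak n)$: 1. $T_{\mathcal{O}_K}=T_{\mathcal{O}_K,\mathcal{O}_K}$ is the identity. 2. $T_{\mathfrak a,\mathfrak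 a}T_{\mathfrak b,\mathfrak b}=T_{\mathfrak a\mathfrak b,\mathfrak a\mathfrak b}=T_{\mathfrak b,\mathfrak b}T_{\mathfrak a,\mathfrak a}$ for all fractional ideals $\mathfrak a,\mathfrak b$ coprime to $\mathfrak n$. 3. $T_{\mathfrak a,\mathfrak a}T_{\mathfrak b}=T_{\mathfrak b}T_{\mathfrak a,\mathfrak a}$ for every fractional ideal $\mathfrak a$ coprime to $\mathfrak n$ and every nonzero integral ideal $\mathfrak b$. 4. $T_{\mathfrak a}T_{\mathfrak b}=T_{\mathfrak a\mathfrak b}=T_{\mathfrak b}T_{\mathfrak a}$ for all coprime nonzero integral ideals $\mathfrak a,\mathfrak b$. 5. $T_{\mathfrak p^n}=(T_{\mathfrak p})^n$ for every nonzero prime ideal $\mathfrak p\mid\mathfrak n$ and every $n\ge1$. 6. $T_{\mathfrak p^n}T_{\mathfrak p}=T_{\mathfrak p^{n+1}}+N(\mathfrak p)\,T_{\mathfrak p^{n-1}}T_{\mathfrak p,\mathfrak p}$ for every nonzero prime ideal $\mathfrak p\nmid\mathfrak n$ and every $n\ge1$. -/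

import Mathlib

open NumberField Module
open scoped TensorProduct nonZeroDivisors

noncomputable section

namespace LatticeHecke

section Lattices

variable (K : Type*) [Field K] [NumberField K]

/-- The algebra `K ⊗_ℚ ℝ`, the product of the Archimedean completions of `K`. -/
abbrev KHat : Type _ := K ⊗[ℚ] ℝ

/-- The space `K̂²` of row vectors of length two over `K̂ = K ⊗_ℚ ℝ`. -/
abbrev KHat2 : Type _ := Fin 2 → KHat K

variable {K}

/-- An `𝓞 K`-submodule `L` of `K̂²` is a lattice if `K̂ L = K̂²`, it is finitely generated,
and `dim_K (K L) = 2`. -/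
structure IsOKLattice (L : Submodule (𝓞 K) (KHat2 K)) : Prop where
  span_eq_top : Submodule.span (KHat K) (L : Set (KHat2 K)) = ⊤
  fg : L.FG
  finrank_eq : finrank K (Submodule.span K (L : Set (KHat2 K))) = 2

/-- The lattice (or module) quotient `M / L`, for `L ⊆ M`. -/
abbrev RelQuot (M L : Submodule (𝓞 K) (KHat2 K)) : Type _ := M ⧸ L.submoduleOf M

/-- `HasIndexIdeal M L 𝔞` says that `L ⊆ M` and that the index ideal `[M : L]` is `𝔞`: the product
of the elementary divisors `𝔞₁ ∣ 𝔞₂` of `M / L ≅ 𝓞 K / 𝔞₁ ⊕ 𝓞 K / 𝔞₂` is `𝔞`. -/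
def HasIndexIdeal (M L : Submodule (𝓞 K) (KHat2 K)) (𝔞 : Ideal (𝓞 K)) : Prop :=
  L ≤ M ∧ ∃ 𝔞₁ 𝔞₂ : Ideal (𝓞 K), 𝔞₁ ∣ 𝔞₂ ∧ 𝔞₁ * 𝔞₂ = 𝔞 ∧
    Nonempty (RelQuot M L ≃ₗ[𝓞 K] (𝓞 K ⧸ 𝔞₁) × (𝓞 K ⧸ 𝔞₂))

/-- The module `𝔟 L` of finite sums `∑ bᵢ xᵢ` with `bᵢ ∈ 𝔟` and `xᵢ ∈ L`, for a fractional
ideal `𝔟`. -/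
def idealSMul (𝔟 : (FractionalIdeal (𝓞 K)⁰ K)ˣ) (L : Submodule (𝓞 K) (KHat2 K)) :
    Submodule (𝓞 K) (KHat2 K) :=
  ((𝔟 : FractionalIdeal (𝓞 K)⁰ K) : Submodule (𝓞 K) K) • L

end Lattices

section Points

variable {K : Type*} [Field K] [NumberField K]

/-- A modular point for `Γ₀(𝔫)`: a pair of lattices `L ⊆ L'` with `L' / L ≅ 𝓞 K / 𝔫`. -/
@[ext]
structure ModularPoint0 (𝔫 : Ideal (𝓞 K)) where
  L : Submodule (𝓞 K) (KHat2 K)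
  L' : Submodule (𝓞 K) (KHat2 K)
  isLattice : IsOKLattice L
  isLattice' : IsOKLattice L'
  le : L ≤ L'
  quot : Nonempty (RelQuot L' L ≃ₗ[𝓞 K] 𝓞 K ⧸ 𝔫)

/-- A modular point for `Γ₁(𝔫)`: a `Γ₀(𝔫)`-modular point `(L, L')` with a generator `β` of `L' / L`.
As `β` only matters modulo `L`, the point records the coset `β + L`, as a subset of `K̂²`. -/
@[ext]
structure ModularPoint1 (𝔫 : Ideal (𝓞 K)) extends ModularPoint0 𝔫 where
  coset : Set (KHat2 K)
  exists_generator : ∃ β ∈ L', L' = L ⊔ Submodule.span (𝓞 K) {β} ∧ coset = {x | x - β ∈ L}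

/-! ### Fractional ideals coprime to the level -/

/-- The group of fractional ideals coprime to `𝔫`: those that are quotients of two nonzero
integral ideals coprime to `𝔫`. -/
def coprimeIdeals (𝔫 : Ideal (𝓞 K)) : Subgroup (FractionalIdeal (𝓞 K)⁰ K)ˣ where
  carrier := {𝔞 | ∃ I J : Ideal (𝓞 K), I ≠ ⊥ ∧ J ≠ ⊥ ∧ IsCoprime I 𝔫 ∧ IsCoprime J 𝔫 ∧
    (𝔞 : FractionalIdeal (𝓞 K)⁰ K) * (J : FractionalIdeal (𝓞 K)⁰ K) = I}
  one_mem' := by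
    refine ⟨1, 1, one_ne_zero, one_ne_zero, isCoprime_one_left, isCoprime_one_left, ?_⟩
    rw [Units.val_one, one_mul]
  mul_mem' := by
    rintro a b ⟨I, J, hI, hJ, cI, cJ, h⟩ ⟨I', J', hI', hJ', cI', cJ', h'⟩
    refine ⟨I * I', J * J', mul_ne_zero hI hI', mul_ne_zero hJ hJ', cI.mul_left cI',
      cJ.mul_left cJ', ?_⟩
    rw [FractionalIdeal.coeIdeal_mul, FractionalIdeal.coeIdeal_mul, Units.val_mul,
      mul_mul_mul_comm, h, h']
  inv_mem' := by
    rintro a ⟨I, J, hI, hJ, cI, cJ, h⟩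
    exact ⟨J, I, hJ, hI, cJ, cI, by rw [← h, Units.inv_mul_cancel_left]⟩

/-- A prime ideal `𝔭 ∤ 𝔫`, as a fractional ideal coprime to `𝔫`. -/
def primeToLevel {𝔫 : Ideal (𝓞 K)} (𝔭 : Ideal (𝓞 K)) (hp : 𝔭.IsPrime) (h0 : 𝔭 ≠ ⊥)
    (hn : ¬ 𝔭 ∣ 𝔫) : coprimeIdeals 𝔫 :=
  ⟨Units.mk0 (𝔭 : FractionalIdeal (𝓞 K)⁰ K) (FractionalIdeal.coeIdeal_ne_zero.mpr h0),
    𝔭, 1, h0, one_ne_zero,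
    (Ideal.isCoprime_iff_sup_eq).mpr ((hp.isMaximal h0).1.2 _ (by
      refine lt_of_le_of_ne le_sup_left fun h => hn (Ideal.dvd_iff_le.mpr ?_)
      rw [h]; exact le_sup_right)),
    isCoprime_one_left, by simp⟩

end Points

section SMulLemmas

variable {K : Type*} [Field K] [NumberField K]

lemma intSMul_eq (r : 𝓞 K) (x : KHat2 K) : r • x = (algebraMap (𝓞 K) K r) • x :=
  (algebraMap_smul K r x).symm

lemma smul_mem_idealSMul {𝔟 : (FractionalIdeal (𝓞 K)⁰ K)ˣ} {L : Submodule (𝓞 K) (KHat2 K)}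
    {c : K} {x : KHat2 K} (hc : c ∈ (𝔟 : FractionalIdeal (𝓞 K)⁰ K)) (hx : x ∈ L) :
    c • x ∈ idealSMul 𝔟 L :=
  Submodule.smul_mem_smul hc hx

lemma idealSMul_le {𝔟 : (FractionalIdeal (𝓞 K)⁰ K)ˣ} {L N : Submodule (𝓞 K) (KHat2 K)} :
    idealSMul 𝔟 L ≤ N ↔ ∀ c ∈ (𝔟 : FractionalIdeal (𝓞 K)⁰ K), ∀ x ∈ L, c • x ∈ N :=
  Submodule.smul_le

lemma idealSMul_mono {𝔟 : (FractionalIdeal (𝓞 K)⁰ K)ˣ} {L N : Submodule (𝓞 K) (KHat2 K)}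
    (h : L ≤ N) : idealSMul 𝔟 L ≤ idealSMul 𝔟 N :=
  idealSMul_le.mpr fun _ hc _ hx => smul_mem_idealSMul hc (h hx)

lemma mul_mem_one {𝔟 : (FractionalIdeal (𝓞 K)⁰ K)ˣ} {c y : K}
    (hc : c ∈ (𝔟 : FractionalIdeal (𝓞 K)⁰ K))
    (hy : y ∈ ((𝔟⁻¹ : (FractionalIdeal (𝓞 K)⁰ K)ˣ) : FractionalIdeal (𝓞 K)⁰ K)) :
    ∃ r : 𝓞 K, algebraMap (𝓞 K) K r = y * c := by
  have h := FractionalIdeal.mul_mem_mul hy hc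
  rw [Units.inv_mul] at h
  exact (FractionalIdeal.mem_one_iff _).mp h

lemma smul_mem_of_mem_idealSMul {𝔟 : (FractionalIdeal (𝓞 K)⁰ K)ˣ}
    {L : Submodule (𝓞 K) (KHat2 K)} {y : K} {x : KHat2 K}
    (hy : y ∈ ((𝔟⁻¹ : (FractionalIdeal (𝓞 K)⁰ K)ˣ) : FractionalIdeal (𝓞 K)⁰ K))
    (hx : x ∈ idealSMul 𝔟 L) : y • x ∈ L := by
  refine Submodule.smul_induction_on hx (fun c hc l hl => ?_) (fun u v hu hv => ?_)
  · obtain ⟨r, hr⟩ := mul_mem_one hc hy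
    rw [smul_smul, ← hr, algebraMap_smul]
    exact L.smul_mem r hl
  · rw [smul_add]; exact L.add_mem hu hv

lemma exists_ne_zero_mem (𝔟 : (FractionalIdeal (𝓞 K)⁰ K)ˣ) :
    ∃ c ∈ (𝔟 : FractionalIdeal (𝓞 K)⁰ K), c ≠ 0 := by
  by_contra! h
  exact 𝔟.ne_zero (FractionalIdeal.eq_zero_iff.mpr h)

/-- `𝔟 L` is a lattice if `L` is one. -/
lemma IsOKLattice.idealSMul {L : Submodule (𝓞 K) (KHat2 K)} (hL : IsOKLattice L)
    (𝔟 : (FractionalIdeal (𝓞 K)⁰ K)ˣ) : IsOKLattice (idealSMul 𝔟 L) := by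
  obtain ⟨c, hc, hc0⟩ := exists_ne_zero_mem 𝔟
  have hK : Submodule.span K (LatticeHecke.idealSMul 𝔟 L : Set (KHat2 K)) =
      Submodule.span K (L : Set (KHat2 K)) := by
    apply le_antisymm
    · refine Submodule.span_le.mpr ?_
      have : LatticeHecke.idealSMul 𝔟 L ≤
          (Submodule.span K (L : Set (KHat2 K))).restrictScalars (𝓞 K) :=
        idealSMul_le.mpr fun d _ x hx => Submodule.smul_mem _ d (Submodule.subset_span hx)
      exact this
    · refine Submodule.span_le.mpr fun x hx => ?_
      have h := Submodule.smul_mem (Submodule.span K (LatticeHecke.idealSMul 𝔟 L : Set (KHat2 K)))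
        c⁻¹ (Submodule.subset_span (smul_mem_idealSMul hc hx))
      rwa [smul_smul, inv_mul_cancel₀ hc0, one_smul] at h
  refine ⟨?_, ?_, by rw [hK]; exact hL.finrank_eq⟩
  · rw [eq_top_iff, ← hL.span_eq_top]
    refine Submodule.span_le.mpr fun x hx => ?_
    have h := Submodule.smul_mem
      (Submodule.span (KHat K) (LatticeHecke.idealSMul 𝔟 L : Set (KHat2 K)))
      (algebraMap K (KHat K) c⁻¹) (Submodule.subset_span (smul_mem_idealSMul hc hx))
    rwa [algebraMap_smul, smul_smul, inv_mul_cancel₀ hc0, one_smul] at h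
  · have hb : ((𝔟 : FractionalIdeal (𝓞 K)⁰ K) : Submodule (𝓞 K) K).FG :=
      FractionalIdeal.fg_unit 𝔟
    exact (hb.map₂ (Algebra.lsmul (𝓞 K) (𝓞 K) (KHat2 K)).toLinearMap hL.fg).of_le
      (idealSMul_le.mpr fun c hc x hx => Submodule.apply_mem_map₂ _ hc hx)

/-- A cyclic quotient with annihilator `𝔫` is isomorphic to `𝓞 K / 𝔫`. -/
lemma quot_of_generator {𝔫 : Ideal (𝓞 K)} {L L' : Submodule (𝓞 K) (KHat2 K)} {β : KHat2 K}
    (h : L' = L ⊔ Submodule.span (𝓞 K) {β}) (hn : ∀ r : 𝓞 K, r • β ∈ L ↔ r ∈ 𝔫) :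
    Nonempty (RelQuot L' L ≃ₗ[𝓞 K] 𝓞 K ⧸ 𝔫) := by
  have hβ : β ∈ L' := h ▸ Submodule.mem_sup_right (Submodule.mem_span_singleton_self β)
  let f : 𝓞 K →ₗ[𝓞 K] RelQuot L' L :=
    (Submodule.mkQ _).comp (LinearMap.toSpanSingleton (𝓞 K) L' ⟨β, hβ⟩)
  have hker : LinearMap.ker f = 𝔫 := by
    ext r
    rw [← hn r, LinearMap.mem_ker]
    change (Submodule.Quotient.mk (r • (⟨β, hβ⟩ : L')) : RelQuot L' L) = 0 ↔ _
    rw [Submodule.Quotient.mk_eq_zero]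
    rfl
  have hsurj : Function.Surjective f := by
    intro q
    obtain ⟨⟨x, hx⟩, rfl⟩ := Submodule.Quotient.mk_surjective _ q
    have hx' := hx
    rw [h] at hx'
    obtain ⟨l, hl, z, hz, rfl⟩ := Submodule.mem_sup.mp hx'
    obtain ⟨r, rfl⟩ := Submodule.mem_span_singleton.mp hz
    refine ⟨r, (Submodule.Quotient.eq _).mpr ?_⟩
    change r • β - (l + r • β) ∈ L
    simpa using hl
  exact ⟨((Submodule.quotEquivOfEq _ _ hker.symm).trans
    (LinearMap.quotKerEquivOfSurjective f hsurj)).symm⟩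

/-- Any generator of a quotient isomorphic to `𝓞 K / 𝔫` has annihilator `𝔫`. -/
lemma smul_generator_mem_iff {𝔫 : Ideal (𝓞 K)} {L L' : Submodule (𝓞 K) (KHat2 K)} {β : KHat2 K}
    (hq : Nonempty (RelQuot L' L ≃ₗ[𝓞 K] 𝓞 K ⧸ 𝔫))
    (h : L' = L ⊔ Submodule.span (𝓞 K) {β}) (r : 𝓞 K) : r • β ∈ L ↔ r ∈ 𝔫 := by
  obtain ⟨e⟩ := hq
  have hβ : β ∈ L' := h ▸ Submodule.mem_sup_right (Submodule.mem_span_singleton_self β)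
  have hL : L ≤ L' := h ▸ le_sup_left
  constructor
  · intro hr
    obtain ⟨q, hq⟩ := e.surjective 1
    obtain ⟨⟨x, hx⟩, rfl⟩ := Submodule.Quotient.mk_surjective _ q
    have hx' := hx
    rw [h] at hx'
    obtain ⟨l, hl, z, hz, rfl⟩ := Submodule.mem_sup.mp hx'
    obtain ⟨s, rfl⟩ := Submodule.mem_span_singleton.mp hz
    have h0 : r • (Submodule.Quotient.mk ⟨l + s • β, hx⟩ : RelQuot L' L) = 0 := by
      rw [← Submodule.Quotient.mk_smul, Submodule.Quotient.mk_eq_zero]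
      change r • (l + s • β) ∈ L
      rw [smul_add, smul_comm r s]
      exact L.add_mem (L.smul_mem r hl) (L.smul_mem s hr)
    have h1 : r • (1 : 𝓞 K ⧸ 𝔫) = 0 := by rw [← hq, ← map_smul, h0, map_zero]
    rw [← map_one (Ideal.Quotient.mk 𝔫)] at h1
    change Ideal.Quotient.mk 𝔫 (r * 1) = 0 at h1
    simpa using Ideal.Quotient.eq_zero_iff_mem.mp h1
  · intro hr
    have h0 : e (r • (Submodule.Quotient.mk ⟨β, hβ⟩ : RelQuot L' L)) = 0 := by
      rw [map_smul]
      obtain ⟨s, hs⟩ := Ideal.Quotient.mk_surjective (e (Submodule.Quotient.mk ⟨β, hβ⟩))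
      rw [← hs]
      change Ideal.Quotient.mk 𝔫 (r * s) = 0
      exact Ideal.Quotient.eq_zero_iff_mem.mpr (𝔫.mul_mem_right s hr)
    rw [map_eq_zero_iff e e.injective, ← Submodule.Quotient.mk_smul,
      Submodule.Quotient.mk_eq_zero] at h0
    exact h0

lemma exists_generator_of_quot {𝔫 : Ideal (𝓞 K)} {L L' : Submodule (𝓞 K) (KHat2 K)}
    (hL : L ≤ L') (hq : Nonempty (RelQuot L' L ≃ₗ[𝓞 K] 𝓞 K ⧸ 𝔫)) :
    ∃ β ∈ L', L' = L ⊔ Submodule.span (𝓞 K) {β} := by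
  obtain ⟨e⟩ := hq
  obtain ⟨⟨β, hβ⟩, hb⟩ := Submodule.Quotient.mk_surjective _ (e.symm 1)
  refine ⟨β, hβ, le_antisymm (fun x hx => ?_)
    (sup_le hL ((Submodule.span_singleton_le_iff_mem _ _).mpr hβ))⟩
  obtain ⟨s, hs⟩ := Ideal.Quotient.mk_surjective (e (Submodule.Quotient.mk ⟨x, hx⟩))
  have h1 : (Submodule.Quotient.mk ⟨x, hx⟩ : RelQuot L' L) =
      s • (Submodule.Quotient.mk ⟨β, hβ⟩ : RelQuot L' L) := by
    apply e.injective
    rw [map_smul, hb, e.apply_symm_apply, ← hs, ← map_one (Ideal.Quotient.mk 𝔫)]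
    change _ = Ideal.Quotient.mk 𝔫 (s * 1)
    rw [mul_one]
  rw [← Submodule.Quotient.mk_smul, Submodule.Quotient.eq] at h1
  have h2 : x - s • β ∈ L := h1
  have h3 : x = (x - s • β) + s • β := by abel
  rw [h3]
  exact Submodule.add_mem_sup h2 (Submodule.smul_mem _ s (Submodule.mem_span_singleton_self β))

/-- If `α ∈ 𝔟` generates `𝔟` modulo `𝔫 𝔟` and `β` generates `L' / L`, then `α β` generates
`𝔟 L' / 𝔟 L`. -/
lemma idealSMul_generator {𝔫 : Ideal (𝓞 K)} {L L' : Submodule (𝓞 K) (KHat2 K)} {β : KHat2 K}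
    (h : L' = L ⊔ Submodule.span (𝓞 K) {β}) (hn : ∀ r : 𝓞 K, r • β ∈ L ↔ r ∈ 𝔫)
    (𝔟 : (FractionalIdeal (𝓞 K)⁰ K)ˣ) {α y : K} {m : 𝓞 K}
    (hα : α ∈ (𝔟 : FractionalIdeal (𝓞 K)⁰ K))
    (hy : y ∈ ((𝔟⁻¹ : (FractionalIdeal (𝓞 K)⁰ K)ˣ) : FractionalIdeal (𝓞 K)⁰ K))
    (hm : m ∈ 𝔫) (hαy : α * y + algebraMap (𝓞 K) K m = 1) :
    idealSMul 𝔟 L' = idealSMul 𝔟 L ⊔ Submodule.span (𝓞 K) {α • β} ∧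
      ∀ r : 𝓞 K, r • (α • β) ∈ idealSMul 𝔟 L ↔ r ∈ 𝔫 := by
  have hβ : β ∈ L' := h ▸ Submodule.mem_sup_right (Submodule.mem_span_singleton_self β)
  have hL : L ≤ L' := h ▸ le_sup_left
  have hmβ : m • β ∈ L := (hn m).mpr hm
  refine ⟨le_antisymm ?_ (sup_le (idealSMul_mono hL)
    ((Submodule.span_singleton_le_iff_mem _ _).mpr (smul_mem_idealSMul hα hβ))), fun r => ?_⟩
  · refine idealSMul_le.mpr fun c hc x hx => ?_
    rw [h] at hx
    obtain ⟨l, hl, z, hz, rfl⟩ := Submodule.mem_sup.mp hx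
    obtain ⟨r, rfl⟩ := Submodule.mem_span_singleton.mp hz
    obtain ⟨t, ht⟩ := mul_mem_one hc hy
    have e : c • (l + r • β) = (c • l + c • (r • (m • β))) + (t * r) • (α • β) := by
      simp only [intSMul_eq, smul_add, smul_smul, map_mul, ht]
      rw [add_assoc, ← add_smul]
      congr 2
      linear_combination (-(c * algebraMap (𝓞 K) K r)) * hαy
    rw [e]
    exact Submodule.add_mem_sup
      (Submodule.add_mem _ (smul_mem_idealSMul hc hl)
        (smul_mem_idealSMul hc (L.smul_mem r hmβ)))
      (Submodule.smul_mem _ _ (Submodule.mem_span_singleton_self _))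
  · rw [← hn r]
    constructor
    · intro hr
      have h1 := smul_mem_of_mem_idealSMul hy hr
      have e : r • β = y • (r • (α • β)) + r • (m • β) := by
        simp only [intSMul_eq, smul_smul]
        rw [← add_smul]
        congr 1
        linear_combination (-(algebraMap (𝓞 K) K r)) * hαy
      rw [e]
      exact L.add_mem h1 (L.smul_mem r hmβ)
    · intro hr
      have e : r • (α • β) = α • (r • β) := by
        simp only [intSMul_eq, smul_smul, mul_comm]
      rw [e]
      exact smul_mem_idealSMul hα hr

/-- Every fractional ideal `𝔟` has an element that generates `𝔟` modulo `𝔫 𝔟`. -/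
lemma exists_generator_mod {𝔫 : Ideal (𝓞 K)} (hn : 𝔫 ≠ ⊥) (𝔟 : (FractionalIdeal (𝓞 K)⁰ K)ˣ) :
    ∃ α ∈ (𝔟 : FractionalIdeal (𝓞 K)⁰ K),
      ∃ y ∈ ((𝔟⁻¹ : (FractionalIdeal (𝓞 K)⁰ K)ˣ) : FractionalIdeal (𝓞 K)⁰ K),
      ∃ m ∈ 𝔫, α * y + algebraMap (𝓞 K) K m = 1 := by
  obtain ⟨d, J, hd, hJ⟩ := FractionalIdeal.exists_eq_spanSingleton_mul
    (𝔟 : FractionalIdeal (𝓞 K)⁰ K)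
  have hJ0 : J ≠ ⊥ := by
    rintro rfl
    exact 𝔟.ne_zero (by rw [hJ]; simp)
  obtain ⟨x, hx⟩ := IsDedekindDomain.exists_sup_span_eq (I := 𝔫 * J) (J := J) Ideal.mul_le_right
    (mul_ne_zero hn hJ0)
  have hd0 : algebraMap (𝓞 K) K d ≠ 0 := by simpa using hd
  have hxJ : x ∈ J := by
    rw [← hx]; exact Ideal.mem_sup_right (Ideal.mem_span_singleton_self x)
  have hα : (algebraMap (𝓞 K) K d)⁻¹ * algebraMap (𝓞 K) K x ∈
      (𝔟 : FractionalIdeal (𝓞 K)⁰ K) := by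
    rw [hJ]
    exact FractionalIdeal.mul_mem_mul (FractionalIdeal.mem_spanSingleton_self _ _)
      (FractionalIdeal.mem_coeIdeal_of_mem _ hxJ)
  set α : K := (algebraMap (𝓞 K) K d)⁻¹ * algebraMap (𝓞 K) K x with hαdef
  have hb : (𝔟 : FractionalIdeal (𝓞 K)⁰ K) =
      (𝔫 : FractionalIdeal (𝓞 K)⁰ K) * 𝔟 + FractionalIdeal.spanSingleton (𝓞 K)⁰ α := by
    have e : (J : FractionalIdeal (𝓞 K)⁰ K) =
        (𝔫 : FractionalIdeal (𝓞 K)⁰ K) * J +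
          FractionalIdeal.spanSingleton (𝓞 K)⁰ (algebraMap (𝓞 K) K x) := by
      conv_lhs => rw [← hx]
      rw [FractionalIdeal.coeIdeal_sup, FractionalIdeal.coeIdeal_mul,
        FractionalIdeal.coeIdeal_span_singleton]
    rw [hαdef, ← FractionalIdeal.spanSingleton_mul_spanSingleton, hJ]
    conv_lhs => rw [e]
    ring
  have h1 : (1 : FractionalIdeal (𝓞 K)⁰ K) = (𝔫 : FractionalIdeal (𝓞 K)⁰ K) +
      FractionalIdeal.spanSingleton (𝓞 K)⁰ α *
        ((𝔟⁻¹ : (FractionalIdeal (𝓞 K)⁰ K)ˣ) : FractionalIdeal (𝓞 K)⁰ K) := by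
    conv_lhs => rw [← Units.mul_inv 𝔟]
    conv_lhs => enter [1]; rw [hb]
    rw [add_mul, mul_assoc, Units.mul_inv, mul_one]
  have h2 : (1 : K) ∈ (𝔫 : FractionalIdeal (𝓞 K)⁰ K) +
      FractionalIdeal.spanSingleton (𝓞 K)⁰ α *
        ((𝔟⁻¹ : (FractionalIdeal (𝓞 K)⁰ K)ˣ) : FractionalIdeal (𝓞 K)⁰ K) := by
    rw [← h1]; exact FractionalIdeal.one_mem_one _
  obtain ⟨u, hu, v, hv, huv⟩ := (FractionalIdeal.mem_add _ _ _).mp h2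
  obtain ⟨m, hm, rfl⟩ := (FractionalIdeal.mem_coeIdeal _).mp hu
  obtain ⟨y, hy, rfl⟩ := FractionalIdeal.mem_singleton_mul.mp hv
  exact ⟨α, hα, y, hy, m, hm, by rw [add_comm]; exact huv⟩

/-- For `𝔞` coprime to `𝔫` there is `u ∈ 𝓞 K ∩ 𝔞⁻¹` with `u ≡ 1` modulo `𝔫` that generates `𝔞⁻¹`
modulo `𝔫 𝔞⁻¹`. -/
lemma exists_unit_mod {𝔫 : Ideal (𝓞 K)} (𝔞 : coprimeIdeals 𝔫) :
    ∃ u : 𝓞 K, u - 1 ∈ 𝔫 ∧ algebraMap (𝓞 K) K u ∈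
        (((𝔞 : (FractionalIdeal (𝓞 K)⁰ K)ˣ)⁻¹ : (FractionalIdeal (𝓞 K)⁰ K)ˣ) :
          FractionalIdeal (𝓞 K)⁰ K) ∧
      ∃ y ∈ ((𝔞 : (FractionalIdeal (𝓞 K)⁰ K)ˣ) : FractionalIdeal (𝓞 K)⁰ K),
      ∃ m ∈ 𝔫, algebraMap (𝓞 K) K u * y + algebraMap (𝓞 K) K m = 1 := by
  obtain ⟨𝔞, I, J, hI, hJ, cI, cJ, h⟩ := 𝔞
  obtain ⟨i, hi, a, ha, hia⟩ := Ideal.isCoprime_iff_exists.mp cI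
  obtain ⟨j, hj, b, hb, hjb⟩ := Ideal.isCoprime_iff_exists.mp cJ
  refine ⟨j, ?_, ?_, algebraMap (𝓞 K) K i, ?_, 1 - j * i, ?_, ?_⟩
  · rw [← hjb, sub_add_cancel_left]; exact neg_mem hb
  · have hle : (J : FractionalIdeal (𝓞 K)⁰ K) ≤
        ((𝔞⁻¹ : (FractionalIdeal (𝓞 K)⁰ K)ˣ) : FractionalIdeal (𝓞 K)⁰ K) := by
      rw [← Units.inv_mul_cancel_left 𝔞 (J : FractionalIdeal (𝓞 K)⁰ K), h]
      exact (mul_le_mul_right FractionalIdeal.coeIdeal_le_one _).trans (by rw [mul_one])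
    exact hle (FractionalIdeal.mem_coeIdeal_of_mem _ hj)
  · have hle : (I : FractionalIdeal (𝓞 K)⁰ K) ≤ (𝔞 : FractionalIdeal (𝓞 K)⁰ K) := by
      rw [← h]
      exact (mul_le_mul_right FractionalIdeal.coeIdeal_le_one _).trans (by rw [mul_one])
    exact hle (FractionalIdeal.mem_coeIdeal_of_mem _ hi)
  · have e : 1 - j * i = b + j * a := by linear_combination (-1 : 𝓞 K) * hjb - j * hia
    rw [e]
    exact 𝔫.add_mem hb (𝔫.mul_mem_left j ha)
  · simp

end SMulLemmas

section Operators

variable {K : Type*} [Field K] [NumberField K] {𝔫 : Ideal (𝓞 K)}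

/-- The point `(𝔟 L, 𝔟 L')`, for a fractional ideal `𝔟` and a `Γ₀(𝔫)`-modular point `(L, L')`. -/
def ModularPoint0.scale (hn : 𝔫 ≠ ⊥) (𝔟 : (FractionalIdeal (𝓞 K)⁰ K)ˣ) (P : ModularPoint0 𝔫) :
    ModularPoint0 𝔫 where
  L := idealSMul 𝔟 P.L
  L' := idealSMul 𝔟 P.L'
  isLattice := P.isLattice.idealSMul 𝔟
  isLattice' := P.isLattice'.idealSMul 𝔟
  le := idealSMul_mono P.le
  quot := by
    obtain ⟨β, -, hβ⟩ := exists_generator_of_quot P.le P.quot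
    obtain ⟨α, hα, y, hy, m, hm, h⟩ := exists_generator_mod hn 𝔟
    have h2 := idealSMul_generator hβ (smul_generator_mem_iff P.quot hβ) 𝔟 hα hy hm h
    exact quot_of_generator h2.1 h2.2

/-- The point `(𝔞⁻¹ L, 𝔞⁻¹ L', β)`, for a fractional ideal `𝔞` coprime to `𝔫` and a
`Γ₁(𝔫)`-modular point `(L, L', β)` whose third component is represented by an element `β` of
`L' ∩ 𝔞⁻¹ L'`. -/
def ModularPoint1.scaleInv (hn : 𝔫 ≠ ⊥) (𝔞 : coprimeIdeals 𝔫) (P : ModularPoint1 𝔫) :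
    ModularPoint1 𝔫 where
  toModularPoint0 := P.toModularPoint0.scale hn (𝔞 : (FractionalIdeal (𝓞 K)⁰ K)ˣ)⁻¹
  coset := {x | ∃ β ∈ P.coset, β ∈ idealSMul (𝔞 : (FractionalIdeal (𝓞 K)⁰ K)ˣ)⁻¹ P.L' ∧
    x - β ∈ idealSMul (𝔞 : (FractionalIdeal (𝓞 K)⁰ K)ˣ)⁻¹ P.L}
  exists_generator := by
    obtain ⟨β, hβ, hgen, hcoset⟩ := P.exists_generator
    obtain ⟨u, hu, hub, y, hy, m, hm, h⟩ := exists_unit_mod 𝔞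
    have hann := smul_generator_mem_iff P.quot hgen
    have h2 := idealSMul_generator hgen hann (𝔞 : (FractionalIdeal (𝓞 K)⁰ K)ˣ)⁻¹ hub
      (by rwa [inv_inv]) hm h
    refine ⟨algebraMap (𝓞 K) K u • β, smul_mem_idealSMul hub hβ, h2.1, ?_⟩
    have hmem : algebraMap (𝓞 K) K u • β ∈ P.coset := by
      rw [hcoset, algebraMap_smul]
      have h3 := (hann _).mpr hu
      rwa [sub_smul, one_smul] at h3
    ext x
    constructor
    · rintro ⟨γ, hγ, hγ', hx⟩
      -- two representatives of the coset in `𝔞⁻¹ L'` differ by an element of `𝔞⁻¹ L`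
      rw [hcoset] at hγ hmem
      have hd : γ - algebraMap (𝓞 K) K u • β ∈ P.L := by
        have h4 := P.L.sub_mem hγ hmem
        rwa [sub_sub_sub_cancel_right] at h4
      have hd' : γ - algebraMap (𝓞 K) K u • β ∈
          idealSMul (𝔞 : (FractionalIdeal (𝓞 K)⁰ K)ˣ)⁻¹ P.L' :=
        Submodule.sub_mem _ hγ' (smul_mem_idealSMul hub hβ)
      rw [h2.1] at hd'
      obtain ⟨l, hl, z, hz, hlz⟩ := Submodule.mem_sup.mp hd'
      obtain ⟨r, rfl⟩ := Submodule.mem_span_singleton.mp hz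
      have h5 : u • (γ - algebraMap (𝓞 K) K u • β) ∈
          idealSMul (𝔞 : (FractionalIdeal (𝓞 K)⁰ K)ˣ)⁻¹ P.L := by
        rw [← algebraMap_smul K u]
        exact smul_mem_idealSMul hub hd
      have h6 : (u * r) • (algebraMap (𝓞 K) K u • β) ∈
          idealSMul (𝔞 : (FractionalIdeal (𝓞 K)⁰ K)ˣ)⁻¹ P.L := by
        rw [← hlz, smul_add, smul_smul] at h5
        exact (Submodule.add_mem_iff_right _ (Submodule.smul_mem _ u hl)).mp h5
      have h7 : r ∈ 𝔫 := by
        have h8 := (h2.2 _).mp h6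
        have h9 : r = u * r - (u - 1) * r := by ring
        rw [h9]
        exact 𝔫.sub_mem h8 (𝔫.mul_mem_right r hu)
      have h10 : γ - algebraMap (𝓞 K) K u • β ∈
          idealSMul (𝔞 : (FractionalIdeal (𝓞 K)⁰ K)ˣ)⁻¹ P.L := by
        rw [← hlz]; exact Submodule.add_mem _ hl ((h2.2 r).mpr h7)
      have h11 := Submodule.add_mem _ hx h10
      rw [sub_add_sub_cancel] at h11
      exact h11
    · intro hx
      exact ⟨_, hmem, smul_mem_idealSMul hub hβ, hx⟩

/-- The `Γ₀(𝔫)`-modular points `(M, M')` with `M ⊇ L`, `[M : L] = 𝔞` and `M' = M + L'`. -/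
def heckeSet0 (𝔞 : Ideal (𝓞 K)) (P : ModularPoint0 𝔫) : Set (ModularPoint0 𝔫) :=
  {Q | HasIndexIdeal Q.L P.L 𝔞 ∧ Q.L' = Q.L ⊔ P.L'}

/-- The `Γ₁(𝔫)`-modular points `(M, M', β)` with `M ⊇ L`, `[M : L] = 𝔞`, `M' = M + L'` and with
the same `β` as the point `(L, L', β)`, that is, with `β + L ⊆ β + M`. -/
def heckeSet1 (𝔞 : Ideal (𝓞 K)) (P : ModularPoint1 𝔫) : Set (ModularPoint1 𝔫) :=
  {Q | Q.toModularPoint0 ∈ heckeSet0 𝔞 P.toModularPoint0 ∧ P.coset ⊆ Q.coset}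

lemma finite_of_fg_of_smul_eq_zero {M : Type*} [AddCommGroup M] [Module (𝓞 K) M]
    [Module.Finite (𝓞 K) M] {m : ℕ} (hm : m ≠ 0) (h : ∀ x : M, (m : 𝓞 K) • x = 0) : Finite M := by
  have : Module.Finite ℤ M := Module.Finite.trans (𝓞 K) M
  refine Module.finite_of_fg_torsion M fun {x} =>
    ⟨⟨(m : ℤ), mem_nonZeroDivisors_of_ne_zero (by exact_mod_cast hm)⟩, ?_⟩
  change (m : ℤ) • x = 0
  rw [natCast_zsmul, ← Nat.cast_smul_eq_nsmul (𝓞 K), h]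

lemma finite_Icc_of_fg {V : Type*} [AddCommGroup V] [Module (𝓞 K) V] {L X : Submodule (𝓞 K) V}
    (hX : X.FG) {m : ℕ} (hm : m ≠ 0) (h : ∀ x ∈ X, (m : 𝓞 K) • x ∈ L) :
    {M | L ≤ M ∧ M ≤ X}.Finite := by
  have : Module.Finite (𝓞 K) X := Module.Finite.iff_fg.mpr hX
  have : Finite (X ⧸ L.submoduleOf X) := by
    refine finite_of_fg_of_smul_eq_zero (K := K) hm fun q => ?_
    obtain ⟨⟨x, hx⟩, rfl⟩ := Submodule.Quotient.mk_surjective _ q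
    rw [← Submodule.Quotient.mk_smul, Submodule.Quotient.mk_eq_zero]
    exact h x hx
  have : Finite (Submodule (𝓞 K) (X ⧸ L.submoduleOf X)) :=
    Finite.of_injective (fun N => (N : Set (X ⧸ L.submoduleOf X))) SetLike.coe_injective
  refine (Set.finite_range fun N : Submodule (𝓞 K) (X ⧸ L.submoduleOf X) =>
    (N.comap (L.submoduleOf X).mkQ).map X.subtype).subset ?_
  rintro M ⟨hLM, hMX⟩
  refine ⟨(M.submoduleOf X).map (L.submoduleOf X).mkQ, ?_⟩
  have h1 : L.submoduleOf X ⊔ M.submoduleOf X = M.submoduleOf X :=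
    sup_eq_right.mpr fun x hx => hLM hx
  dsimp only
  rw [Submodule.comap_map_mkQ, h1, Submodule.submoduleOf, Submodule.map_comap_subtype]
  exact inf_eq_right.mpr hMX

lemma smul_eq_zero_of_equiv {M : Type*} [AddCommGroup M] [Module (𝓞 K) M] {𝔞₁ 𝔞₂ : Ideal (𝓞 K)}
    (e : M ≃ₗ[𝓞 K] (𝓞 K ⧸ 𝔞₁) × (𝓞 K ⧸ 𝔞₂)) {r : 𝓞 K} (hr : r ∈ 𝔞₁ * 𝔞₂) (x : M) :
    r • x = 0 := by
  apply e.injective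
  rw [map_smul, map_zero]
  obtain ⟨u, hu⟩ := Ideal.Quotient.mk_surjective (e x).1
  obtain ⟨v, hv⟩ := Ideal.Quotient.mk_surjective (e x).2
  refine Prod.ext ?_ ?_
  · rw [Prod.smul_fst, ← hu]
    change Ideal.Quotient.mk 𝔞₁ (r * u) = 0
    exact Ideal.Quotient.eq_zero_iff_mem.mpr (Ideal.mul_mem_right _ _ (Ideal.mul_le_left hr))
  · rw [Prod.smul_snd, ← hv]
    change Ideal.Quotient.mk 𝔞₂ (r * v) = 0
    exact Ideal.Quotient.eq_zero_iff_mem.mpr (Ideal.mul_mem_right _ _ (Ideal.mul_le_right hr))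

/-- A lattice has only finitely many super-lattices of given index ideal, so that the sums that
define the Hecke operators are finite. -/
lemma finite_hasIndexIdeal {L : Submodule (𝓞 K) (KHat2 K)} (hL : L.FG) {𝔞 : Ideal (𝓞 K)}
    (h0 : 𝔞 ≠ ⊥) : {M | HasIndexIdeal M L 𝔞}.Finite := by
  obtain ⟨m, hm0, hma⟩ : ∃ m : ℕ, m ≠ 0 ∧ (m : 𝓞 K) ∈ 𝔞 :=
    ⟨Ideal.absNorm 𝔞, by rwa [Ne, Ideal.absNorm_eq_zero_iff], Ideal.absNorm_mem 𝔞⟩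
  have hmK : (m : K) ≠ 0 := by exact_mod_cast hm0
  obtain ⟨X, hXfg, hX⟩ : ∃ X : Submodule (𝓞 K) (KHat2 K), X.FG ∧
      ∀ x, x ∈ X ↔ (m : 𝓞 K) • x ∈ L := by
    refine ⟨L.map ((Algebra.lsmul (𝓞 K) (𝓞 K) (KHat2 K)).toLinearMap ((m : K)⁻¹)), hL.map _,
      fun x => ⟨?_, fun h => ⟨_, h, ?_⟩⟩⟩
    · rintro ⟨l, hl, rfl⟩
      rw [intSMul_eq, map_natCast]
      change (m : K) • ((m : K)⁻¹ • l) ∈ L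
      rwa [smul_smul, mul_inv_cancel₀ hmK, one_smul]
    · rw [intSMul_eq, map_natCast]
      change (m : K)⁻¹ • ((m : K) • x) = x
      rw [smul_smul, inv_mul_cancel₀ hmK, one_smul]
  refine (finite_Icc_of_fg hXfg hm0 fun x hx => (hX x).mp hx).subset ?_
  rintro M ⟨hLM, 𝔞₁, 𝔞₂, -, h12, ⟨e⟩⟩
  refine ⟨hLM, fun x hx => (hX x).mpr ?_⟩
  have hz := smul_eq_zero_of_equiv e (h12 ▸ hma) (Submodule.Quotient.mk ⟨x, hx⟩)
  rw [← Submodule.Quotient.mk_smul, Submodule.Quotient.mk_eq_zero] at hz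
  exact hz

lemma finite_heckeSet0 {𝔞 : Ideal (𝓞 K)} (h0 : 𝔞 ≠ ⊥) (P : ModularPoint0 𝔫) :
    (heckeSet0 𝔞 P).Finite := by
  refine Set.Finite.of_finite_image (f := fun Q : ModularPoint0 𝔫 => Q.L)
    ((finite_hasIndexIdeal P.isLattice.fg h0).subset ?_) ?_
  · rintro _ ⟨Q, hQ, rfl⟩
    exact hQ.1
  · rintro Q hQ R hR (h : Q.L = R.L)
    exact ModularPoint0.ext h (by rw [hQ.2, hR.2, h])

lemma finite_heckeSet1 {𝔞 : Ideal (𝓞 K)} (h0 : 𝔞 ≠ ⊥) (P : ModularPoint1 𝔫) :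
    (heckeSet1 𝔞 P).Finite := by
  refine Set.Finite.of_finite_image (f := fun Q : ModularPoint1 𝔫 => Q.toModularPoint0)
    ((finite_heckeSet0 h0 P.toModularPoint0).subset ?_) ?_
  · rintro _ ⟨Q, hQ, rfl⟩
    exact hQ.1
  · rintro Q hQ R hR (h : Q.toModularPoint0 = R.toModularPoint0)
    have hL : Q.L = R.L := by rw [h]
    refine ModularPoint1.ext hL (by rw [h]) ?_
    obtain ⟨β, -, -, hβ⟩ := P.exists_generator
    obtain ⟨γ, -, -, hγ⟩ := Q.exists_generator
    obtain ⟨δ, -, -, hδ⟩ := R.exists_generator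
    have hP : β ∈ P.coset := by rw [hβ]; simp
    have h1 := hQ.2 hP
    have h2 := hR.2 hP
    rw [hγ] at h1
    rw [hδ] at h2
    have h3 : γ - δ ∈ R.L := by
      have h4 := R.L.sub_mem h2 (hL ▸ h1 : β - γ ∈ R.L)
      rwa [sub_sub_sub_cancel_left] at h4
    rw [hγ, hδ, hL]
    ext x
    change x - γ ∈ R.L ↔ x - δ ∈ R.L
    rw [← sub_add_sub_cancel x γ δ]
    exact (Submodule.add_mem_iff_left _ h3).symm

/-- The operator `T_𝔞` on `ℚ 𝓜₀(𝔫)`: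
`T_𝔞 (L, L') = N(𝔞)⁻¹ ∑ (M, M')`, over the finite set `heckeSet0`. -/
def T0 (𝔫 𝔞 : Ideal (𝓞 K)) : Module.End ℚ (ModularPoint0 𝔫 →₀ ℚ) :=
  Finsupp.linearCombination ℚ fun P =>
    (Ideal.absNorm 𝔞 : ℚ)⁻¹ • ∑ᶠ Q ∈ heckeSet0 𝔞 P, Finsupp.single Q 1

/-- The operator `T_𝔞` on `ℚ 𝓜₁(𝔫)`:
`T_𝔞 (L, L', β) = N(𝔞)⁻¹ ∑ (M, M', β)`, over the finite set `heckeSet1`. -/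
def T1 (𝔫 𝔞 : Ideal (𝓞 K)) : Module.End ℚ (ModularPoint1 𝔫 →₀ ℚ) :=
  Finsupp.linearCombination ℚ fun P =>
    (Ideal.absNorm 𝔞 : ℚ)⁻¹ • ∑ᶠ Q ∈ heckeSet1 𝔞 P, Finsupp.single Q 1

/-- The operator `T_{𝔞,𝔞}` on `ℚ 𝓜₀(𝔫)`:
`T_{𝔞,𝔞} (L, L') = N(𝔞)⁻² (𝔞⁻¹ L, 𝔞⁻¹ L')`, for every fractional ideal `𝔞`. -/
def S0 (hn : 𝔫 ≠ ⊥) (𝔞 : (FractionalIdeal (𝓞 K)⁰ K)ˣ) :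
    Module.End ℚ (ModularPoint0 𝔫 →₀ ℚ) :=
  Finsupp.linearCombination ℚ fun P =>
    Finsupp.single (P.scale hn 𝔞⁻¹)
      ((FractionalIdeal.absNorm (𝔞 : FractionalIdeal (𝓞 K)⁰ K) ^ 2)⁻¹)

/-- The operator `T_{𝔞,𝔞}` on `ℚ 𝓜₁(𝔫)`:
`T_{𝔞,𝔞} (L, L', β) = N(𝔞)⁻² (𝔞⁻¹ L, 𝔞⁻¹ L', β)`, where `β ∈ L' ∩ 𝔞⁻¹ L'`, for every fractional
ideal `𝔞` coprime to `𝔫`. -/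
def S1 (hn : 𝔫 ≠ ⊥) (𝔞 : coprimeIdeals 𝔫) : Module.End ℚ (ModularPoint1 𝔫 →₀ ℚ) :=
  Finsupp.linearCombination ℚ fun P =>
    Finsupp.single (P.scaleInv hn 𝔞)
      ((FractionalIdeal.absNorm
        ((𝔞 : (FractionalIdeal (𝓞 K)⁰ K)ˣ) : FractionalIdeal (𝓞 K)⁰ K) ^ 2)⁻¹)

end Operators

end LatticeHecke

end

open LatticeHecke

noncomputable section

namespace LatticeHecke

set_option linter.unusedSectionVars false

variable {K : Type*} [Field K] [NumberField K]

/-! ### Indices of lattices -/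

/-! Only a few formal properties of modular points matter, and `HeckeSystem` collects them: the
points above a given point are determined by their lattices, every lattice between two comparable
points carries a point, and fractional ideals coprime to the level act compatibly with everything.
The relations are proved once for such a system and then applied to both kinds of points.

Let `Q` lie above `P`, with lattices `M ⊇ L`. Up to the factor `N(𝔞𝔟)⁻¹`, the coefficient of `Q` in
`T_𝔞 T_𝔟 P` is the number of lattices `N` with `L ⊆ N ⊆ M`, `[N : L] = 𝔟` and `[M : N] = 𝔞`
(`T_mul_T_single`). If `𝔞` and `𝔟` are coprime, then `M / L` is the direct sum of its `𝔞`-part and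
its `𝔟`-part, so there is exactly one `N`.

For `T_{𝔭ⁿ} T_𝔭` the lattices `N` are the lines of the plane `𝔭⁻¹L / L` that are contained in `M /
L`. There are `N(𝔭) + 1` of them if `𝔭⁻¹L ⊆ M`, and exactly one otherwise, because two distinct
lines span the plane (`ncard_hasIndexIdeal_prime_le`). If `𝔭 ∣ 𝔫`, the first case is impossible: the
generator of `L' / L` would have too small an annihilating order modulo `M`. If `𝔭 ∤ 𝔫`, the points
with `𝔭⁻¹L ⊆ M` are those above `(𝔭⁻¹L, 𝔭⁻¹L')`, and the excess `N(𝔭)` in their coefficients is the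
term with `T_{𝔭,𝔭}`.

This needs index ideals to be multiplicative in towers. For powers of `𝔭` this reduces to counting:
lattices have rank two, so the elementary divisor theorem makes `[M : L]` depend only on the
cardinality of `M / L`, once a power of `𝔭` kills that quotient (`hasIndexIdeal_pow_iff`). -/

/-- The index of `L ∩ M` in `M`, as a natural number. -/
abbrev idx (L M : Submodule (𝓞 K) (KHat2 K)) : ℕ :=
  L.toAddSubgroup.relIndex M.toAddSubgroup

lemma idx_eq_card (L M : Submodule (𝓞 K) (KHat2 K)) : idx L M = Nat.card (RelQuot M L) := rfl

lemma idx_self (L : Submodule (𝓞 K) (KHat2 K)) : idx L L = 1 :=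
  AddSubgroup.relIndex_self _

lemma idx_mul_idx {L M N : Submodule (𝓞 K) (KHat2 K)} (h₁ : L ≤ M) (h₂ : M ≤ N) :
    idx L M * idx M N = idx L N :=
  AddSubgroup.relIndex_mul_relIndex _ _ _ h₁ h₂

/-- An infinite index is recorded as `0`, so `h0` is the finiteness that allows cancellation. -/
lemma eq_of_idx_eq {L M N : Submodule (𝓞 K) (KHat2 K)} (h₁ : L ≤ M) (h₂ : M ≤ N)
    (h : idx L M = idx L N) (h0 : idx L N ≠ 0) : M = N := by
  have h3 := idx_mul_idx h₁ h₂
  rw [h] at h3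
  have h4 : idx M N = 1 := (mul_eq_left₀ h0).mp h3
  exact le_antisymm h₂ (AddSubgroup.relIndex_eq_one.mp h4)

lemma card_quotient_eq_absNorm (I : Ideal (𝓞 K)) : Nat.card (𝓞 K ⧸ I) = Ideal.absNorm I := by
  rw [Ideal.absNorm_apply, Submodule.cardQuot_apply]

lemma one_lt_absNorm {𝔭 : Ideal (𝓞 K)} (hp : 𝔭.IsPrime) (h0 : 𝔭 ≠ ⊥) :
    1 < Ideal.absNorm 𝔭 := by
  have h1 : Ideal.absNorm 𝔭 ≠ 0 := by rwa [Ne, Ideal.absNorm_eq_zero_iff]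
  have h2 : Ideal.absNorm 𝔭 ≠ 1 := by rw [Ne, Ideal.absNorm_eq_one_iff]; exact hp.ne_top
  omega

/-- If `𝔭` kills the class of `x` modulo `A`, and `x ∉ A`, then `𝔭` is the annihilator of that
class. -/
lemma mem_iff_of_prime {𝔭 : Ideal (𝓞 K)} (hp : 𝔭.IsPrime) (h0 : 𝔭 ≠ ⊥)
    {A : Submodule (𝓞 K) (KHat2 K)} {x : KHat2 K} (hx : x ∉ A) (hpx : ∀ r ∈ 𝔭, r • x ∈ A)
    (r : 𝓞 K) : r • x ∈ A ↔ r ∈ 𝔭 := by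
  refine ⟨fun hr => ?_, hpx r⟩
  by_contra hrp
  have hmax := hp.isMaximal h0
  obtain ⟨y, i, hi, hyi⟩ := hmax.exists_inv hrp
  refine hx ?_
  have e : x = y • (r • x) + i • x := by rw [smul_smul, ← add_smul, hyi, one_smul]
  rw [e]
  exact A.add_mem (A.smul_mem y hr) (hpx i hi)

lemma idx_sup_span {𝔭 : Ideal (𝓞 K)} (hp : 𝔭.IsPrime) (h0 : 𝔭 ≠ ⊥)
    {A : Submodule (𝓞 K) (KHat2 K)} {x : KHat2 K} (hx : x ∉ A) (hpx : ∀ r ∈ 𝔭, r • x ∈ A) :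
    idx A (A ⊔ Submodule.span (𝓞 K) {x}) = Ideal.absNorm 𝔭 := by
  obtain ⟨e⟩ := quot_of_generator rfl (mem_iff_of_prime hp h0 hx hpx)
  rw [idx_eq_card, Nat.card_congr e.toEquiv, card_quotient_eq_absNorm]

/-! ### Rank and reduction of a lattice modulo a prime -/

section Reduction

variable {M : Submodule (𝓞 K) (KHat2 K)}

/-- Extension of scalars to the fraction field preserves the rank, and `K ⊗ M` is the `K`-span of
`M`. -/
lemma IsOKLattice.finrank (hM : IsOKLattice M) : Module.finrank (𝓞 K) M = 2 := by
  have : Module.Flat (𝓞 K) K := IsLocalization.flat K (𝓞 K)⁰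
  exact (TensorProduct.isBaseChange (𝓞 K) M K).finrank_eq.symm.trans
    ((M.tensorEquivSpan K).finrank_eq.trans hM.finrank_eq)

instance : Module.IsTorsionFree (𝓞 K) (KHat2 K) :=
  Module.IsTorsionFree.trans_faithfulSMul (𝓞 K) K (KHat2 K)

/-- If `M` is a lattice, then `M / 𝔭 M` has `N(𝔭)²` elements. -/
lemma IsOKLattice.idx_smul (hM : IsOKLattice M) {𝔭 : Ideal (𝓞 K)} (hp : 𝔭.IsPrime)
    (h0 : 𝔭 ≠ ⊥) : idx (𝔭 • M) M = Ideal.absNorm 𝔭 ^ 2 := by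
  have := hp.isMaximal h0
  have : Module.Finite (𝓞 K) M := Module.Finite.iff_fg.mpr hM.fg
  -- A finitely generated torsion-free module over a Dedekind domain is projective, so its fibre at
  -- `𝔭` has dimension equal to its rank.
  have h1 := Ideal.finrank_fiber_eq_finrank (M := M) 𝔭
  rw [hM.finrank] at h1
  let e1 : (𝓞 K ⧸ 𝔭) ≃ₗ[𝓞 K] 𝔭.ResidueField :=
    LinearEquiv.ofBijective (Algebra.linearMap (𝓞 K ⧸ 𝔭) 𝔭.ResidueField |>.restrictScalars (𝓞 K))
      𝔭.bijective_algebraMap_quotient_residueField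
  have hfin : Finite (𝓞 K ⧸ 𝔭) := Ideal.finiteQuotientOfFreeOfNeBot 𝔭 h0
  have : Finite 𝔭.ResidueField := Finite.of_equiv _ e1.toEquiv
  have e2 : 𝔭.Fiber M ≃ₗ[𝓞 K] (M ⧸ 𝔭 • (⊤ : Submodule (𝓞 K) M)) :=
    (TensorProduct.congr e1.symm (LinearEquiv.refl (𝓞 K) M)).trans
      (TensorProduct.quotTensorEquivQuotSMul M 𝔭)
  have e3 : (M ⧸ 𝔭 • (⊤ : Submodule (𝓞 K) M)) ≃ₗ[𝓞 K] RelQuot M (𝔭 • M) :=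
    Submodule.quotEquivOfEq _ _ (Submodule.map_injective_of_injective M.injective_subtype
      (by simp [Submodule.submoduleOf, Submodule.smul_le_right]))
  rw [idx_eq_card, ← Nat.card_congr (e2.trans e3).toEquiv,
    Module.natCard_eq_pow_finrank (K := 𝔭.ResidueField), h1, ← Nat.card_congr e1.toEquiv,
    card_quotient_eq_absNorm]

end Reduction

/-! ### Quotients of lattices that are killed by a power of a prime -/

/-- An ideal that contains `𝔭 ^ m` is a power of `𝔭`. -/
lemma eq_pow_of_pow_le {𝔭 : Ideal (𝓞 K)} (hp : 𝔭.IsPrime) (h0 : 𝔭 ≠ ⊥) {I : Ideal (𝓞 K)}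
    {m : ℕ} (h : 𝔭 ^ m ≤ I) : ∃ i ≤ m, I = 𝔭 ^ i := by
  obtain ⟨i, hi, h1⟩ := (dvd_prime_pow (Ideal.prime_of_isPrime h0 hp) m).mp
    (Ideal.dvd_iff_le.mpr h)
  exact ⟨i, hi, associated_iff_eq.mp h1⟩

section Structure

variable {Q : Type*} [AddCommGroup Q] [Module (𝓞 K) Q] {𝔭 : Ideal (𝓞 K)}

/-- A module that is killed by a power of `𝔭` is generated by elements that generate it
modulo `𝔭`. -/
lemma eq_top_of_sup_smul_top {m : ℕ} (hm : ∀ r ∈ 𝔭 ^ m, ∀ x : Q, r • x = 0)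
    {N : Submodule (𝓞 K) Q} (h : 𝔭 • ⊤ ⊔ N = ⊤) : N = ⊤ := by
  -- Nakayama by iteration: substituting `Q = 𝔭Q + N` into `𝔭ᵏQ` raises the exponent by one. As `𝔭`
  -- acts nilpotently, the process ends with `Q = N`.
  have key : ∀ k : ℕ, 𝔭 ^ k • (⊤ : Submodule (𝓞 K) Q) ⊔ N = ⊤ := by
    intro k
    induction k with
    | zero => simp
    | succ k ih =>
      refine eq_top_iff.mpr (ih.symm.le.trans (sup_le ?_ le_sup_right))
      conv_lhs => rw [← h]
      rw [Submodule.smul_sup, pow_succ, Submodule.mul_smul]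
      exact sup_le_sup_left Submodule.smul_le_right _
  have h1 : 𝔭 ^ m • (⊤ : Submodule (𝓞 K) Q) = ⊥ :=
    (Submodule.eq_bot_iff _).mpr fun x hx =>
      Submodule.smul_induction_on hx (fun r hr y _ => hm r hr y) (fun y z hy hz => by
        rw [hy, hz, add_zero])
  rw [← key m, h1, bot_sup_eq]

/-- Two generators `x`, `y` of a module give an isomorphism with `𝓞 K / I × 𝓞 K / J` if the
relations between them are those of a direct sum. -/
lemma equiv_prod_of_generators {x y : Q} (hxy : Submodule.span (𝓞 K) {x, y} = ⊤)
    {I J : Ideal (𝓞 K)} (h : ∀ a b : 𝓞 K, a • x + b • y = 0 ↔ a ∈ I ∧ b ∈ J) :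
    Nonempty (Q ≃ₗ[𝓞 K] (𝓞 K ⧸ I) × (𝓞 K ⧸ J)) := by
  have hx : I ≤ LinearMap.ker (LinearMap.toSpanSingleton (𝓞 K) Q x) := fun a ha => by
    simpa using (h a 0).mpr ⟨ha, J.zero_mem⟩
  have hy : J ≤ LinearMap.ker (LinearMap.toSpanSingleton (𝓞 K) Q y) := fun b hb => by
    simpa using (h 0 b).mpr ⟨I.zero_mem, hb⟩
  let f : (𝓞 K ⧸ I) × (𝓞 K ⧸ J) →ₗ[𝓞 K] Q :=
    (Submodule.liftQ I _ hx).coprod (Submodule.liftQ J _ hy)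
  have hf : ∀ a b : 𝓞 K, f (Ideal.Quotient.mk I a, Ideal.Quotient.mk J b) = a • x + b • y :=
    fun a b => rfl
  refine ⟨(LinearEquiv.ofBijective f ⟨?_, fun q => ?_⟩).symm⟩
  · refine (injective_iff_map_eq_zero f).mpr ?_
    rintro ⟨u, v⟩ huv
    obtain ⟨a, rfl⟩ := Ideal.Quotient.mk_surjective u
    obtain ⟨b, rfl⟩ := Ideal.Quotient.mk_surjective v
    rw [hf, h] at huv
    exact Prod.ext (Ideal.Quotient.eq_zero_iff_mem.mpr huv.1)
      (Ideal.Quotient.eq_zero_iff_mem.mpr huv.2)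
  · have hq : q ∈ Submodule.span (𝓞 K) {x, y} := hxy ▸ Submodule.mem_top
    obtain ⟨a, b, rfl⟩ := Submodule.mem_span_pair.mp hq
    exact ⟨_, hf a b⟩

/-- If `x` has annihilator `𝔭 ^ j` in a module killed by `𝔭 ^ j`, then every `y` can be modified
by a multiple of `x` such that its order becomes that of its class modulo `x`. -/
lemma exists_sub_smul_eq_zero (h0 : 𝔭 ≠ ⊥) {i j : ℕ} (hij : i ≤ j) {x y : Q}
    (hj : ∀ r ∈ 𝔭 ^ j, ∀ z : Q, r • z = 0) (hx : ∀ r : 𝓞 K, r • x = 0 → r ∈ 𝔭 ^ j)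
    (hy : ∀ r ∈ 𝔭 ^ i, ∃ s : 𝓞 K, r • y = s • x) :
    ∃ s : 𝓞 K, ∀ r ∈ 𝔭 ^ i, r • (y - s • x) = 0 := by
  -- Modulo `𝔭ʲ` the ideal `𝔭ⁱ` is generated by a single element `t`, so it suffices to make `t`
  -- kill the modified `y`.
  obtain ⟨t, ht⟩ := IsDedekindDomain.exists_sup_span_eq (Ideal.pow_le_pow_right hij)
    (pow_ne_zero j h0)
  have hti : t ∈ 𝔭 ^ i := by
    rw [← ht]; exact Ideal.mem_sup_right (Ideal.mem_span_singleton_self t)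
  obtain ⟨r, hr⟩ := hy t hti
  -- Multiplying `t y = r x` by `𝔭ʲ⁻ⁱ` kills the left side. As `x` has annihilator `𝔭ʲ`, this gives
  -- `𝔭ʲ⁻ⁱ r ⊆ 𝔭ʲ`, and `𝔭ʲ⁻ⁱ` cancels. Hence `r ≡ s t` modulo `𝔭ʲ` for some `s`, the required
  -- multiplier.
  have hri : r ∈ 𝔭 ^ i := by
    have h1 : 𝔭 ^ (j - i) * Ideal.span {r} ≤ 𝔭 ^ (j - i) * 𝔭 ^ i := by
      rw [← pow_add, Nat.sub_add_cancel hij]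
      refine Ideal.mul_le.mpr fun u hu v hv => hx _ ?_
      obtain ⟨w, rfl⟩ := Ideal.mem_span_singleton'.mp hv
      have h2 : u * t ∈ 𝔭 ^ j := by
        rw [← Nat.sub_add_cancel hij, pow_add]; exact Ideal.mul_mem_mul hu hti
      rw [show u * (w * r) = w * u * r by ring, mul_smul, ← hr, ← mul_smul,
        show w * u * t = w * (u * t) by ring, mul_smul, hj _ h2, smul_zero]
    have h2 := (mul_dvd_mul_iff_left (pow_ne_zero (j - i) h0)).mp (Ideal.dvd_iff_le.mpr h1)
    exact Ideal.dvd_span_singleton.mp h2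
  rw [← ht] at hri
  obtain ⟨w, hw, v, hv, rfl⟩ := Submodule.mem_sup.mp hri
  obtain ⟨s, rfl⟩ := Ideal.mem_span_singleton'.mp hv
  have hts : t • (y - s • x) = 0 := by
    rw [smul_sub, hr, add_smul, hj w hw, zero_add, smul_smul, mul_comm t s, sub_self]
  refine ⟨s, fun a ha => ?_⟩
  rw [← ht] at ha
  obtain ⟨b, hb, c, hc, rfl⟩ := Submodule.mem_sup.mp ha
  obtain ⟨d, rfl⟩ := Ideal.mem_span_singleton'.mp hc
  rw [add_smul, hj b hb, zero_add, mul_smul, hts, smul_zero]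

/-- The elementary divisor theorem for a module that is killed by a power of a prime `𝔭` and
generated by two elements modulo `𝔭`, one of which can be chosen at will. -/
lemma exists_equiv_of_pow_smul_eq_zero (hp : 𝔭.IsPrime) (h0 : 𝔭 ≠ ⊥) {m : ℕ}
    (hm : ∀ r ∈ 𝔭 ^ m, ∀ x : Q, r • x = 0)
    (h2 : ∀ x : Q, x ∉ 𝔭 • (⊤ : Submodule (𝓞 K) Q) →
      ∃ y, 𝔭 • ⊤ ⊔ Submodule.span (𝓞 K) {x, y} = ⊤) :
    ∃ i j, i ≤ j ∧ Nonempty (Q ≃ₗ[𝓞 K] (𝓞 K ⧸ 𝔭 ^ i) × (𝓞 K ⧸ 𝔭 ^ j)) := by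
  classical
  have hex : ∃ m, ∀ r ∈ 𝔭 ^ m, ∀ x : Q, r • x = 0 := ⟨m, hm⟩
  -- Let `𝔭ʲ` be the exact exponent of `Q`. An element `x` of this order cannot lie in `𝔭Q`, so it
  -- belongs to a generating pair; splitting off the largest cyclic factor first makes the
  -- complement exist.
  obtain ⟨j, hj, hjmin⟩ : ∃ j, (∀ r ∈ 𝔭 ^ j, ∀ x : Q, r • x = 0) ∧
      ∀ k < j, ¬ ∀ r ∈ 𝔭 ^ k, ∀ x : Q, r • x = 0 :=
    ⟨Nat.find hex, Nat.find_spec hex, fun k hk => Nat.find_min hex hk⟩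
  rcases Nat.eq_zero_or_pos j with rfl | hj0
  · have hz : ∀ x : Q, x = 0 := fun x => by
      have h1 := hj 1 (by simp) x
      rwa [one_smul] at h1
    refine ⟨0, 0, le_rfl, equiv_prod_of_generators (x := 0) (y := 0) ?_ fun a b => by simp⟩
    exact eq_top_iff.mpr fun x _ => by rw [hz x]; exact Submodule.zero_mem _
  obtain ⟨k, rfl⟩ : ∃ k, j = k + 1 := ⟨j - 1, by omega⟩
  have h3 := hjmin k (Nat.lt_succ_self k)
  push Not at h3
  obtain ⟨c, hc, x, hcx⟩ := h3
  have hxp : x ∉ 𝔭 • (⊤ : Submodule (𝓞 K) Q) := by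
    intro hx
    refine hcx (Submodule.smul_induction_on hx (fun r hr y _ => ?_) (fun y z hy hz => ?_))
    · rw [smul_smul]
      exact hj _ (by rw [pow_succ]; exact Ideal.mul_mem_mul hc hr) y
    · rw [smul_add, hy, hz, add_zero]
  obtain ⟨y, hy⟩ := h2 x hxp
  have hspan := eq_top_of_sup_smul_top hj hy
  have hx : ∀ r : 𝓞 K, r • x = 0 → r ∈ 𝔭 ^ (k + 1) := by
    obtain ⟨i, hi, hi'⟩ := eq_pow_of_pow_le hp h0
      (I := LinearMap.ker (LinearMap.toSpanSingleton (𝓞 K) Q x)) (m := k + 1)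
      (fun r hr => by simpa using hj r hr x)
    have hik : i = k + 1 := by
      by_contra hne
      have h5 : c ∈ 𝔭 ^ i := Ideal.pow_le_pow_right (by omega) hc
      rw [← hi'] at h5
      exact hcx (by simpa using h5)
    intro r hr
    have h6 : r ∈ LinearMap.ker (LinearMap.toSpanSingleton (𝓞 K) Q x) := by simpa using hr
    rwa [hi', hik] at h6
  -- Here `𝔭ⁱ` is the order of `y` modulo the span of `x`. Correcting `y` by a multiple of `x` gives
  -- it this order in `Q` itself, and the sum becomes direct.
  obtain ⟨i, hi, hi'⟩ := eq_pow_of_pow_le hp h0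
    (I := (Submodule.span (𝓞 K) {x}).comap (LinearMap.toSpanSingleton (𝓞 K) Q y)) (m := k + 1)
    (fun r hr => by simp [hj r hr y])
  have hyi : ∀ r : 𝓞 K, r ∈ 𝔭 ^ i ↔ ∃ s : 𝓞 K, r • y = s • x := fun r => by
    rw [← hi', Submodule.mem_comap, Submodule.mem_span_singleton]
    simp only [LinearMap.toSpanSingleton_apply, eq_comm]
  obtain ⟨s, hs⟩ := exists_sub_smul_eq_zero h0 hi hj hx fun r hr => (hyi r).mp hr
  refine ⟨i, k + 1, hi, equiv_prod_of_generators (x := y - s • x) (y := x) ?_ fun a b => ?_⟩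
  · refine eq_top_iff.mpr (hspan.symm.le.trans (Submodule.span_le.mpr ?_))
    rintro z (rfl | rfl)
    · exact Submodule.subset_span (by simp)
    · exact Submodule.mem_span_pair.mpr ⟨1, s, by simp⟩
  · constructor
    · intro hab
      have ha : a ∈ 𝔭 ^ i := (hyi a).mpr ⟨a * s - b, by
        rw [smul_sub, smul_smul] at hab
        rw [sub_smul, ← sub_eq_zero, ← hab]; abel⟩
      rw [hs a ha, zero_add] at hab
      exact ⟨ha, hx b hab⟩
    · rintro ⟨ha, hb⟩
      rw [hs a ha, hj b hb, add_zero]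

end Structure

/-! ### Index ideals that are powers of a prime -/

section PrimePowerIndex

variable {L M N : Submodule (𝓞 K) (KHat2 K)} {𝔭 : Ideal (𝓞 K)}

lemma HasIndexIdeal.le {𝔞 : Ideal (𝓞 K)} (h : HasIndexIdeal M L 𝔞) : L ≤ M := h.1

lemma HasIndexIdeal.idx_eq {𝔞 : Ideal (𝓞 K)} (h : HasIndexIdeal M L 𝔞) :
    idx L M = Ideal.absNorm 𝔞 := by
  obtain ⟨-, 𝔞₁, 𝔞₂, -, rfl, ⟨e⟩⟩ := h
  rw [idx_eq_card, Nat.card_congr e.toEquiv, Nat.card_prod, card_quotient_eq_absNorm,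
    card_quotient_eq_absNorm, map_mul]

lemma HasIndexIdeal.smul_mem {𝔞 : Ideal (𝓞 K)} (h : HasIndexIdeal M L 𝔞) {r : 𝓞 K} (hr : r ∈ 𝔞)
    {x : KHat2 K} (hx : x ∈ M) : r • x ∈ L := by
  obtain ⟨-, 𝔞₁, 𝔞₂, -, rfl, ⟨e⟩⟩ := h
  have hz := smul_eq_zero_of_equiv e hr (Submodule.Quotient.mk ⟨x, hx⟩)
  rw [← Submodule.Quotient.mk_smul, Submodule.Quotient.mk_eq_zero] at hz
  exact hz

/-- A nonzero vector of the plane `M / 𝔭M` extends to a basis: each class adjoined multiplies the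
index by `N(𝔭)`, and the total is `N(𝔭)²`. -/
lemma IsOKLattice.exists_sup_eq (hM : IsOKLattice M) (hp : 𝔭.IsPrime) (h0 : 𝔭 ≠ ⊥)
    {x : KHat2 K} (hxM : x ∈ M) (hx : x ∉ 𝔭 • M) :
    ∃ y ∈ M, 𝔭 • M ⊔ Submodule.span (𝓞 K) {x} ⊔ Submodule.span (𝓞 K) {y} = M := by
  have hidx := hM.idx_smul hp h0
  have hN := one_lt_absNorm hp h0
  have h1 := idx_sup_span hp h0 hx fun r hr => Submodule.smul_mem_smul hr hxM
  set A := 𝔭 • M ⊔ Submodule.span (𝓞 K) {x} with hA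
  have hAM : A ≤ M := sup_le Submodule.smul_le_right
    ((Submodule.span_singleton_le_iff_mem _ _).mpr hxM)
  obtain ⟨y, hy, hyA⟩ : ∃ y ∈ M, y ∉ A := by
    by_contra! h
    have h2 : A = M := le_antisymm hAM h
    rw [h2, hidx] at h1
    nlinarith
  refine ⟨y, hy, ?_⟩
  have h2 := idx_sup_span hp h0 hyA fun r hr =>
    le_sup_left (a := 𝔭 • M) (Submodule.smul_mem_smul hr hy)
  refine eq_of_idx_eq (L := 𝔭 • M) (le_sup_left.trans le_sup_left) (sup_le hAM
    ((Submodule.span_singleton_le_iff_mem _ _).mpr hy)) ?_ ?_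
  · rw [← idx_mul_idx (M := A) le_sup_left le_sup_left, h1, h2, hidx, sq]
  · rw [hidx]; positivity

/-- If `M` is a lattice and `L ⊆ M` contains `𝔭ᵐ M`, then the index ideal `[M : L]` is determined
by the index of `L` in `M` as an abelian group. -/
lemma hasIndexIdeal_pow_iff (hM : IsOKLattice M) (hp : 𝔭.IsPrime) (h0 : 𝔭 ≠ ⊥) {k : ℕ} :
    HasIndexIdeal M L (𝔭 ^ k) ↔
      L ≤ M ∧ (∃ m, 𝔭 ^ m • M ≤ L) ∧ idx L M = Ideal.absNorm 𝔭 ^ k := by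
  constructor
  · intro h
    exact ⟨h.le, ⟨k, Submodule.smul_le.mpr fun r hr x hx => h.smul_mem hr hx⟩,
      by rw [h.idx_eq, map_pow]⟩
  · rintro ⟨hLM, ⟨m, hm⟩, hidx⟩
    have h2 : ∀ q : RelQuot M L, q ∉ 𝔭 • (⊤ : Submodule (𝓞 K) (RelQuot M L)) →
        ∃ y, 𝔭 • ⊤ ⊔ Submodule.span (𝓞 K) {q, y} = ⊤ := by
      intro q hq
      obtain ⟨⟨x, hxM⟩, rfl⟩ := Submodule.Quotient.mk_surjective _ q
      -- The class of `𝔭M` in `M / L` lies in `𝔭(M / L)`, so a class outside `𝔭(M / L)` lifts to an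
      -- element outside `𝔭M`, where a second generator is available.
      have hpM : 𝔭 • M ≤ ((𝔭 • (⊤ : Submodule (𝓞 K) (RelQuot M L))).comap
          (L.submoduleOf M).mkQ).map M.subtype :=
        Submodule.smul_le.mpr fun r hr z hz =>
          ⟨r • ⟨z, hz⟩, Submodule.smul_mem_smul hr (Submodule.mem_top (x := (Submodule.mkQ
            (L.submoduleOf M) ⟨z, hz⟩))), rfl⟩
      have hx : x ∉ 𝔭 • M := by
        intro hx
        obtain ⟨z, hz, rfl⟩ := hpM hx
        exact hq hz
      obtain ⟨y, hy, hxy⟩ := hM.exists_sup_eq hp h0 hxM hx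
      refine ⟨Submodule.Quotient.mk ⟨y, hy⟩, eq_top_iff.mpr fun q _ => ?_⟩
      obtain ⟨⟨z, hz⟩, rfl⟩ := Submodule.Quotient.mk_surjective _ q
      have hz' := hz
      rw [← hxy, sup_assoc] at hz'
      obtain ⟨u, hu, v, hv, rfl⟩ := Submodule.mem_sup.mp hz'
      obtain ⟨v₁, hv₁, v₂, hv₂, rfl⟩ := Submodule.mem_sup.mp hv
      obtain ⟨a, rfl⟩ := Submodule.mem_span_singleton.mp hv₁
      obtain ⟨b, rfl⟩ := Submodule.mem_span_singleton.mp hv₂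
      obtain ⟨w, hw, rfl⟩ := hpM hu
      have hw' : (Submodule.Quotient.mk w : RelQuot M L) ∈
          𝔭 • (⊤ : Submodule (𝓞 K) (RelQuot M L)) := hw
      exact Submodule.add_mem_sup hw' (Submodule.mem_span_pair.mpr ⟨a, b, rfl⟩)
    have hm' : ∀ r ∈ 𝔭 ^ m, ∀ q : RelQuot M L, r • q = 0 := by
      intro r hr q
      obtain ⟨⟨x, hx⟩, rfl⟩ := Submodule.Quotient.mk_surjective _ q
      rw [← Submodule.Quotient.mk_smul, Submodule.Quotient.mk_eq_zero]
      exact hm (Submodule.smul_mem_smul hr hx)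
    obtain ⟨i, j, hij, ⟨e⟩⟩ := exists_equiv_of_pow_smul_eq_zero hp h0 hm' h2
    refine ⟨hLM, 𝔭 ^ i, 𝔭 ^ j, pow_dvd_pow 𝔭 hij, ?_, ⟨e⟩⟩
    -- The cardinality `N(𝔭)ⁱ⁺ʲ` determines `i + j`, as `N(𝔭) > 1`.
    rw [idx_eq_card, Nat.card_congr e.toEquiv, Nat.card_prod, card_quotient_eq_absNorm,
      card_quotient_eq_absNorm, map_pow, map_pow, ← pow_add] at hidx
    rw [← pow_add, Nat.pow_right_injective (one_lt_absNorm hp h0) hidx]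

end PrimePowerIndex

/-! ### Coprime index ideals, and invariance of the index ideal under scaling -/

section Coprime

variable {L M N : Submodule (𝓞 K) (KHat2 K)} {𝔞 𝔟 : Ideal (𝓞 K)}

lemma relQuot_equiv_of_surjective {A : Type*} [AddCommGroup A] [Module (𝓞 K) A]
    (g : M →ₗ[𝓞 K] A) (hg : Function.Surjective g) (h : ∀ x : M, g x = 0 ↔ (x : KHat2 K) ∈ L) :
    Nonempty (RelQuot M L ≃ₗ[𝓞 K] A) :=
  ⟨(Submodule.quotEquivOfEq _ _ (Submodule.ext fun x => (h x).symm)).trans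
    (g.quotKerEquivOfSurjective hg)⟩

/-- If `M / N` and `N / L` have coprime annihilators, then `M / L` is their direct sum. -/
lemma relQuot_equiv_prod (hNM : N ≤ M) {u v : 𝓞 K} (huv : u + v = 1)
    (hu : ∀ x ∈ M, u • x ∈ N) (hv : ∀ x ∈ N, v • x ∈ L) (hLN : L ≤ N) :
    Nonempty (RelQuot M L ≃ₗ[𝓞 K] RelQuot M N × RelQuot N L) := by
  have e : ∀ x : KHat2 K, x = u • x + v • x := fun x => by rw [← add_smul, huv, one_smul]
  -- Multiplication by `u = 1 - v` maps `M` into `N` and is the identity on `N / L`; it gives the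
  -- projection of `M / L` onto `N / L`.
  let g₂ : M →ₗ[𝓞 K] N := (u • M.subtype).codRestrict N fun x => hu x x.2
  let g : M →ₗ[𝓞 K] RelQuot M N × RelQuot N L :=
    (N.submoduleOf M).mkQ.prod ((L.submoduleOf N).mkQ.comp g₂)
  refine relQuot_equiv_of_surjective g ?_ fun x => ?_
  · rintro ⟨p, q⟩
    obtain ⟨⟨x, hx⟩, rfl⟩ := Submodule.Quotient.mk_surjective _ p
    obtain ⟨⟨y, hy⟩, rfl⟩ := Submodule.Quotient.mk_surjective _ q
    -- The elements `u` and `v` act as complementary idempotents: `v` is the identity on `M / N` and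
    -- zero on `N / L`, and `u` the reverse.
    refine ⟨⟨v • x + u • y, M.add_mem (M.smul_mem v hx) (M.smul_mem u (hNM hy))⟩, Prod.ext ?_ ?_⟩
    · refine (Submodule.Quotient.eq _).mpr ?_
      change v • x + u • y - x ∈ N
      have h1 : v • x + u • y - x = u • y - u • x := by
        nth_rw 2 [e x]; abel
      rw [h1]
      exact N.sub_mem (N.smul_mem u hy) (hu x hx)
    · refine (Submodule.Quotient.eq _).mpr ?_
      change u • (v • x + u • y) - y ∈ L
      have h1 : u • (v • x + u • y) - y = v • (u • x) - v • ((u + 1) • y) := by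
        obtain rfl : u = 1 - v := eq_sub_of_add_eq huv
        module
      rw [h1]
      exact L.sub_mem (hv _ (hu x hx)) (hv _ (N.smul_mem _ hy))
  · change (Submodule.Quotient.mk x, Submodule.Quotient.mk (g₂ x)) =
      (0 : RelQuot M N × RelQuot N L) ↔ _
    rw [Prod.mk_eq_zero, Submodule.Quotient.mk_eq_zero, Submodule.Quotient.mk_eq_zero]
    change (x : KHat2 K) ∈ N ∧ u • (x : KHat2 K) ∈ L ↔ _
    refine ⟨fun h => ?_, fun h => ⟨hLN h, L.smul_mem u h⟩⟩
    rw [e x]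
    exact L.add_mem h.2 (hv _ h.1)

/-- The Chinese remainder theorem, as an isomorphism of modules. -/
def quotientMulLinearEquiv {I J : Ideal (𝓞 K)} (h : IsCoprime I J) :
    (𝓞 K ⧸ (I * J)) ≃ₗ[𝓞 K] (𝓞 K ⧸ I) × (𝓞 K ⧸ J) :=
  (Ideal.quotientMulEquivQuotientProd I J h).toAddEquiv.toLinearEquiv fun c x => by
    obtain ⟨t, rfl⟩ := Ideal.Quotient.mk_surjective x
    rfl

def prodQuotientMulLinearEquiv {I₁ I₂ J₁ J₂ : Ideal (𝓞 K)} (h₁ : IsCoprime I₁ J₁)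
    (h₂ : IsCoprime I₂ J₂) : ((𝓞 K ⧸ (I₁ * J₁)) × (𝓞 K ⧸ (I₂ * J₂))) ≃ₗ[𝓞 K]
      ((𝓞 K ⧸ I₁) × (𝓞 K ⧸ I₂)) × ((𝓞 K ⧸ J₁) × (𝓞 K ⧸ J₂)) :=
  ((quotientMulLinearEquiv h₁).prodCongr (quotientMulLinearEquiv h₂)).trans
    (LinearEquiv.prodProdProdComm (𝓞 K) _ _ _ _)

/-- The extension `M / L` splits by coprimality, and the Chinese remainder theorem merges the
elementary divisors pairwise into `𝔞ᵢ𝔟ᵢ`. -/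
lemma HasIndexIdeal.mul (h₁ : HasIndexIdeal N L 𝔟) (h₂ : HasIndexIdeal M N 𝔞)
    (h : IsCoprime 𝔞 𝔟) : HasIndexIdeal M L (𝔞 * 𝔟) := by
  obtain ⟨u, hu, v, hv, huv⟩ := Ideal.isCoprime_iff_exists.mp h
  obtain ⟨e⟩ := relQuot_equiv_prod h₂.le huv (fun x hx => h₂.smul_mem hu hx)
    (fun x hx => h₁.smul_mem hv hx) h₁.le
  obtain ⟨hLN, 𝔟₁, 𝔟₂, hb, rfl, ⟨e₁⟩⟩ := h₁
  obtain ⟨hNM, 𝔞₁, 𝔞₂, ha, rfl, ⟨e₂⟩⟩ := h₂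
  refine ⟨hLN.trans hNM, 𝔞₁ * 𝔟₁, 𝔞₂ * 𝔟₂, mul_dvd_mul ha hb, mul_mul_mul_comm _ _ _ _,
    ⟨(e.trans (e₂.prodCongr e₁)).trans (prodQuotientMulLinearEquiv ?_ ?_).symm⟩⟩
  · exact h.of_mul_left_left.of_mul_right_left
  · exact h.of_mul_left_right.of_mul_right_right

lemma exists_between_of_relQuot_equiv {A B : Type*} [AddCommGroup A] [Module (𝓞 K) A]
    [AddCommGroup B] [Module (𝓞 K) B] (hLM : L ≤ M) (e : RelQuot M L ≃ₗ[𝓞 K] A × B) :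
    ∃ N, L ≤ N ∧ N ≤ M ∧ Nonempty (RelQuot M N ≃ₗ[𝓞 K] A) ∧
      Nonempty (RelQuot N L ≃ₗ[𝓞 K] B) := by
  let g : M →ₗ[𝓞 K] A × B := e.toLinearMap.comp (L.submoduleOf M).mkQ
  have hg : Function.Surjective g := e.surjective.comp (Submodule.mkQ_surjective _)
  have hker : ∀ x : M, g x = 0 ↔ (x : KHat2 K) ∈ L := fun x => by
    change e (Submodule.Quotient.mk x) = 0 ↔ _
    rw [map_eq_zero_iff e e.injective, Submodule.Quotient.mk_eq_zero]
    rfl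
  let N : Submodule (𝓞 K) (KHat2 K) :=
    (LinearMap.ker ((LinearMap.fst (𝓞 K) A B).comp g)).map M.subtype
  have hN : ∀ x : M, (x : KHat2 K) ∈ N ↔ (g x).1 = 0 := fun x => by
    constructor
    · rintro ⟨y, hy, hyx⟩
      rw [← Subtype.ext hyx]
      exact hy
    · intro hx
      exact ⟨x, hx, rfl⟩
  have hNM : N ≤ M := Submodule.map_subtype_le _ _
  refine ⟨N, fun x hx => ?_, hNM, ?_, ?_⟩
  · rw [hN ⟨x, hLM hx⟩, (hker ⟨x, hLM hx⟩).mpr hx, Prod.fst_zero]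
  · exact relQuot_equiv_of_surjective ((LinearMap.fst (𝓞 K) A B).comp g)
      (Prod.fst_surjective.comp hg) fun x => (hN x).symm
  · refine relQuot_equiv_of_surjective
      (((LinearMap.snd (𝓞 K) A B).comp g).comp (Submodule.inclusion hNM)) (fun b => ?_) fun x => ?_
    · obtain ⟨x, hx⟩ := hg (0, b)
      refine ⟨⟨x, (hN x).mpr (by rw [hx])⟩, ?_⟩
      change (g x).2 = b
      rw [hx]
    · rw [← hker ⟨x, hNM x.2⟩, Prod.ext_iff]
      exact ⟨fun h => ⟨(hN ⟨x, hNM x.2⟩).mp x.2, h⟩, fun h => h.2⟩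

/-- Each elementary divisor of `M / L` factors into a part dividing `𝔞` and a part dividing `𝔟`. The
`𝔟`-parts make up `N / L`, and coprimality forces the products of the parts to be `𝔞` and `𝔟`
exactly. -/
lemma HasIndexIdeal.exists_between (h : HasIndexIdeal M L (𝔞 * 𝔟)) (hab : IsCoprime 𝔞 𝔟) :
    ∃ N, HasIndexIdeal N L 𝔟 ∧ HasIndexIdeal M N 𝔞 := by
  obtain ⟨hLM, 𝔠₁, 𝔠₂, hc, hc', ⟨e⟩⟩ := h
  obtain ⟨𝔞₁, 𝔟₁, ha₁, hb₁, rfl⟩ := exists_dvd_and_dvd_of_dvd_mul (hc' ▸ Dvd.intro _ rfl)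
  obtain ⟨𝔞₂, 𝔟₂, ha₂, hb₂, rfl⟩ := exists_dvd_and_dvd_of_dvd_mul (hc' ▸ Dvd.intro_left _ rfl)
  have hcop : ∀ {I J : Ideal (𝓞 K)}, I ∣ 𝔞 → J ∣ 𝔟 → IsCoprime I J := fun hI hJ =>
    (hab.of_isCoprime_of_dvd_left hI).of_isCoprime_of_dvd_right hJ
  rw [mul_mul_mul_comm] at hc'
  have hab' : IsCoprime (𝔞₁ * 𝔞₂) 𝔟 := (hcop ha₁ dvd_rfl).mul_left (hcop ha₂ dvd_rfl)
  have hba' : IsCoprime 𝔞 (𝔟₁ * 𝔟₂) := (hcop dvd_rfl hb₁).mul_right (hcop dvd_rfl hb₂)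
  have ha : 𝔞₁ * 𝔞₂ = 𝔞 := dvd_antisymm (hab'.dvd_of_dvd_mul_right (hc' ▸ Dvd.intro _ rfl))
    (hba'.dvd_of_dvd_mul_right (hc'.symm ▸ Dvd.intro _ rfl))
  have hb : 𝔟₁ * 𝔟₂ = 𝔟 := dvd_antisymm
    (hba'.symm.dvd_of_dvd_mul_left (hc' ▸ Dvd.intro_left _ rfl))
    (hab'.symm.dvd_of_dvd_mul_left (hc'.symm ▸ Dvd.intro_left _ rfl))
  obtain ⟨N, hLN, hNM, hA, hB⟩ := exists_between_of_relQuot_equiv hLM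
    (e.trans (prodQuotientMulLinearEquiv (hcop ha₁ hb₁) (hcop ha₂ hb₂)))
  refine ⟨N, ⟨hLN, 𝔟₁, 𝔟₂, ?_, hb, hB⟩, ⟨hNM, 𝔞₁, 𝔞₂, ?_, ha, hA⟩⟩
  · exact (hcop ha₂ hb₁).symm.dvd_of_dvd_mul_left ((Dvd.intro_left _ rfl).trans hc)
  · exact (hcop ha₁ hb₂).dvd_of_dvd_mul_right ((Dvd.intro _ rfl).trans hc)

/-- With `u + v = 1`, `u ∈ 𝔞`, `v ∈ 𝔟`, every `x ∈ N` is `ux + vx` with `ux ∈ N₀` and `vx ∈ L`. So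
`N ⊆ N₀`, and the indices over `L` agree and are finite. -/
lemma HasIndexIdeal.eq_of_le {N₀ : Submodule (𝓞 K) (KHat2 K)} (h₁ : HasIndexIdeal N₀ L 𝔟)
    (h₂ : HasIndexIdeal M N₀ 𝔞) (hab : IsCoprime 𝔞 𝔟) (hb : 𝔟 ≠ ⊥)
    (h₃ : HasIndexIdeal N L 𝔟) (hNM : N ≤ M) : N = N₀ := by
  obtain ⟨u, hu, v, hv, huv⟩ := Ideal.isCoprime_iff_exists.mp hab
  refine eq_of_idx_eq h₃.le (fun x hx => ?_) (h₃.idx_eq.trans h₁.idx_eq.symm) ?_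
  · rw [← one_smul (𝓞 K) x, ← huv, add_smul]
    exact N₀.add_mem (h₂.smul_mem hu (hNM hx)) (h₁.le (h₃.smul_mem hv hx))
  · rwa [h₁.idx_eq, Ne, Ideal.absNorm_eq_zero_iff]

lemma HasIndexIdeal.eq_of_top (h : HasIndexIdeal M L ⊤) : M = L :=
  le_antisymm (fun x hx => by
    simpa using h.smul_mem (r := 1) Submodule.mem_top hx) h.le

lemma hasIndexIdeal_self (L : Submodule (𝓞 K) (KHat2 K)) : HasIndexIdeal L L ⊤ := by
  refine ⟨le_rfl, ⊤, ⊤, dvd_rfl, Ideal.top_mul ⊤, ?_⟩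
  have : Subsingleton (𝓞 K ⧸ (⊤ : Ideal (𝓞 K))) := Ideal.Quotient.subsingleton_iff.mpr rfl
  exact relQuot_equiv_of_surjective 0 (fun _ => ⟨0, Subsingleton.elim _ _⟩) (by simp)

/-- Choose `α ∈ 𝔠` and `y ∈ 𝔠⁻¹` with `αy ≡ 1` modulo `𝔞`. As `𝔞` kills `M / L`, multiplication by
`y` and by `α` are inverse isomorphisms between `𝔠M / 𝔠L` and `M / L`, even if `𝔠` is not principal.
-/
lemma HasIndexIdeal.idealSMul (h : HasIndexIdeal M L 𝔞) (h0 : 𝔞 ≠ ⊥)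
    (𝔠 : (FractionalIdeal (𝓞 K)⁰ K)ˣ) : HasIndexIdeal (idealSMul 𝔠 M) (idealSMul 𝔠 L) 𝔞 := by
  obtain ⟨α, hα, y, hy, m, hm, hαy⟩ := exists_generator_mod h0 𝔠
  have hmul : ∀ {x : KHat2 K}, x ∈ M → m • x ∈ L := fun hx => h.smul_mem hm hx
  have hmul' : LatticeHecke.idealSMul 𝔠 M ≤
      (LatticeHecke.idealSMul 𝔠 L).comap (LinearMap.lsmul (𝓞 K) (KHat2 K) m) :=
    idealSMul_le.mpr fun c hc x hx => by
      rw [Submodule.mem_comap, LinearMap.lsmul_apply, smul_comm]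
      exact smul_mem_idealSMul hc (hmul hx)
  have e : ∀ x : KHat2 K, x = α • (y • x) + m • x := fun x => by
    rw [intSMul_eq, smul_smul, ← add_smul, hαy, one_smul]
  let g₁ : LatticeHecke.idealSMul 𝔠 M →ₗ[𝓞 K] M :=
    (((Algebra.lsmul (𝓞 K) (𝓞 K) (KHat2 K)).toLinearMap y).comp
      (LatticeHecke.idealSMul 𝔠 M).subtype).codRestrict M fun x => smul_mem_of_mem_idealSMul hy x.2
  obtain ⟨hLM, 𝔞₁, 𝔞₂, hdvd, hmulab, ⟨e₁⟩⟩ := h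
  have hsurj : Function.Surjective ((L.submoduleOf M).mkQ.comp g₁) := fun q => by
    obtain ⟨⟨x, hx⟩, rfl⟩ := Submodule.Quotient.mk_surjective _ q
    refine ⟨⟨α • x, smul_mem_idealSMul hα hx⟩, (Submodule.Quotient.eq _).mpr ?_⟩
    change y • (α • x) - x ∈ L
    have h1 : y • (α • x) - x = -(m • x) := by
      nth_rw 2 [e x]; rw [smul_comm]; abel
    rw [h1]
    exact L.neg_mem (hmul hx)
  obtain ⟨e₂⟩ := relQuot_equiv_of_surjective (L := LatticeHecke.idealSMul 𝔠 L) _ hsurj fun x => by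
    rw [LinearMap.comp_apply, Submodule.mkQ_apply, Submodule.Quotient.mk_eq_zero]
    change y • (x : KHat2 K) ∈ L ↔ _
    refine ⟨fun hx => ?_, fun hx => smul_mem_of_mem_idealSMul hy hx⟩
    rw [e x]
    exact Submodule.add_mem _ (smul_mem_idealSMul hα hx) (hmul' x.2)
  exact ⟨idealSMul_mono hLM, 𝔞₁, 𝔞₂, hdvd, hmulab, ⟨e₂.trans e₁⟩⟩

end Coprime
/-! ### Superlattices of prime index -/

/-! ### Lines in a plane over the residue field -/

section Lines

variable {Q : Type*} [AddCommGroup Q] [Module (𝓞 K) Q] {𝔭 : Ideal (𝓞 K)}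

lemma card_span_singleton (hp : 𝔭.IsPrime) (h0 : 𝔭 ≠ ⊥) (hQ : ∀ r ∈ 𝔭, ∀ x : Q, r • x = 0)
    {x : Q} (hx : x ≠ 0) : Nat.card (Submodule.span (𝓞 K) {x}) = Ideal.absNorm 𝔭 := by
  have hker : LinearMap.ker (LinearMap.toSpanSingleton (𝓞 K) Q x) = 𝔭 := by
    refine ((hp.isMaximal h0).eq_of_le (fun h => hx ?_) fun r hr => by simpa using hQ r hr x).symm
    have h1 : (1 : 𝓞 K) ∈ LinearMap.ker (LinearMap.toSpanSingleton (𝓞 K) Q x) := by simp [h]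
    simpa using h1
  rw [← card_quotient_eq_absNorm, ← hker, LinearMap.span_singleton_eq_range]
  exact (Nat.card_congr (LinearMap.quotKerEquivRange _).toEquiv).symm

/-- A plane over the residue field of `𝔭` contains `N(𝔭) + 1` lines. -/
lemma ncard_lines (hp : 𝔭.IsPrime) (h0 : 𝔭 ≠ ⊥) (hQ : ∀ r ∈ 𝔭, ∀ x : Q, r • x = 0)
    (hcard : Nat.card Q = Ideal.absNorm 𝔭 ^ 2) :
    {W : Submodule (𝓞 K) Q | Nat.card W = Ideal.absNorm 𝔭}.ncard = Ideal.absNorm 𝔭 + 1 := by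
  classical
  have hN := one_lt_absNorm hp h0
  have hfin : Finite Q := Nat.finite_of_card_ne_zero (by rw [hcard]; positivity)
  have := Fintype.ofFinite Q
  have hsub : Finite (Submodule (𝓞 K) Q) :=
    Finite.of_injective (fun N => (N : Set Q)) SetLike.coe_injective
  set S := {W : Submodule (𝓞 K) Q | Nat.card W = Ideal.absNorm 𝔭} with hS
  have hSfin : S.Finite := Set.toFinite S
  -- Partition the nonzero vectors by the line that they span. Each line contains `N(𝔭) - 1` of
  -- them, and `N(𝔭)² - 1 = (N(𝔭) + 1)(N(𝔭) - 1)`.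
  have h1 : (Finset.univ.erase (0 : Q)).card =
      ∑ W ∈ hSfin.toFinset, ((Finset.univ.erase (0 : Q)).filter
        fun x => Submodule.span (𝓞 K) {x} = W).card :=
    Finset.card_eq_sum_card_fiberwise fun x hx => by
      have hx0 : x ≠ 0 := by simpa using hx
      rw [Set.Finite.coe_toFinset]
      exact card_span_singleton hp h0 hQ hx0
  have h2 : ∀ W ∈ hSfin.toFinset, ((Finset.univ.erase (0 : Q)).filter
      fun x => Submodule.span (𝓞 K) {x} = W).card = Ideal.absNorm 𝔭 - 1 := by
    intro W hW
    have hWc : Nat.card W = Ideal.absNorm 𝔭 := by simpa using hW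
    have h3 : ((Finset.univ.erase (0 : Q)).filter fun x => Submodule.span (𝓞 K) {x} = W) =
        (Finset.univ.filter fun x => x ∈ W).erase 0 := by
      ext x
      simp only [Finset.mem_filter, Finset.mem_erase, Finset.mem_univ, and_true, true_and]
      refine and_congr_right fun hx => ⟨fun h => h ▸ Submodule.mem_span_singleton_self x,
        fun h => ?_⟩
      refine SetLike.coe_injective (Set.eq_of_subset_of_ncard_le
        ((Submodule.span_singleton_le_iff_mem _ _).mpr h) (le_of_eq ?_))
      exact hWc.trans (card_span_singleton hp h0 hQ hx).symm
    rw [h3, Finset.card_erase_of_mem (by simp), ← hWc, Nat.card_eq_fintype_card,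
      Fintype.card_subtype]
  rw [Finset.sum_congr rfl h2, Finset.sum_const, smul_eq_mul, Finset.card_erase_of_mem
    (Finset.mem_univ _), Finset.card_univ, ← Nat.card_eq_fintype_card, hcard,
    ← Set.ncard_eq_toFinset_card] at h1
  obtain ⟨k, hk⟩ : ∃ k, Ideal.absNorm 𝔭 = k + 1 := ⟨Ideal.absNorm 𝔭 - 1, by omega⟩
  rw [hk] at h1 hN ⊢
  have h4 : (k + 1) ^ 2 - 1 = (k + 2) * k := by
    rw [show (k + 1) ^ 2 = (k + 2) * k + 1 by ring, Nat.add_sub_cancel]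
  rw [h4, Nat.add_sub_cancel] at h1
  exact (Nat.eq_of_mul_eq_mul_right (by omega) h1).symm

end Lines

/-! ### The lattice `𝔭⁻¹L` and the superlattices of index `𝔭` -/

section PrimeIndex

variable {L M N P R : Submodule (𝓞 K) (KHat2 K)} {𝔭 : Ideal (𝓞 K)}

/-- The `K`-spans of `L` and `M` both have dimension two, so they coincide with that of `N`; finite
generation holds because `𝓞 K` is Noetherian. -/
lemma IsOKLattice.of_between (hL : IsOKLattice L) (hM : IsOKLattice M) (hLN : L ≤ N)
    (hNM : N ≤ M) : IsOKLattice N := by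
  refine ⟨?_, ?_, ?_⟩
  · rw [eq_top_iff, ← hL.span_eq_top]
    exact Submodule.span_mono hLN
  · have : Module.Finite (𝓞 K) M := Module.Finite.iff_fg.mpr hM.fg
    have := isNoetherian_of_isNoetherianRing_of_finite (𝓞 K) M
    exact (isNoetherian_submodule.mp this) N hNM
  · have h1 : Submodule.span K (L : Set (KHat2 K)) ≤ Submodule.span K (N : Set (KHat2 K)) :=
      Submodule.span_mono hLN
    have h2 : Submodule.span K (N : Set (KHat2 K)) ≤ Submodule.span K (M : Set (KHat2 K)) :=
      Submodule.span_mono hNM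
    have hfin : Module.Finite K (Submodule.span K (M : Set (KHat2 K))) :=
      Module.finite_of_finrank_pos (by rw [hM.finrank_eq]; norm_num)
    have h3 : Submodule.span K (L : Set (KHat2 K)) = Submodule.span K (M : Set (KHat2 K)) :=
      Submodule.eq_of_le_of_finrank_eq (h1.trans h2) (by rw [hL.finrank_eq, hM.finrank_eq])
    rw [le_antisymm h2 (h3 ▸ h1), hM.finrank_eq]

lemma idealSMul_mk0 {I : Ideal (𝓞 K)} (h0 : (I : FractionalIdeal (𝓞 K)⁰ K) ≠ 0)
    (M : Submodule (𝓞 K) (KHat2 K)) : idealSMul (Units.mk0 _ h0) M = I • M := by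
  refine le_antisymm (idealSMul_le.mpr fun c hc x hx => ?_) (Submodule.smul_le.mpr fun r hr x hx => ?_)
  · obtain ⟨r, hr, rfl⟩ := (FractionalIdeal.mem_coeIdeal _).mp hc
    rw [algebraMap_smul]
    exact Submodule.smul_mem_smul hr hx
  · rw [intSMul_eq]
    exact smul_mem_idealSMul ((FractionalIdeal.mem_coeIdeal _).mpr ⟨r, hr, rfl⟩) hx

lemma idealSMul_mul (𝔞 𝔟 : (FractionalIdeal (𝓞 K)⁰ K)ˣ) (L : Submodule (𝓞 K) (KHat2 K)) :
    idealSMul (𝔞 * 𝔟) L = idealSMul 𝔞 (idealSMul 𝔟 L) := by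
  rw [idealSMul, Units.val_mul, FractionalIdeal.coe_mul, ← smul_eq_mul, Submodule.smul_assoc]
  rfl

lemma idealSMul_one (L : Submodule (𝓞 K) (KHat2 K)) : idealSMul 1 L = L := by
  rw [idealSMul, Units.val_one, FractionalIdeal.coe_one, Submodule.one_smul]

/-- The lattice `𝔭⁻¹ L`. -/
def invSMul (𝔭 : Ideal (𝓞 K)) (h0 : 𝔭 ≠ ⊥) (L : Submodule (𝓞 K) (KHat2 K)) :
    Submodule (𝓞 K) (KHat2 K) :=
  idealSMul (Units.mk0 (𝔭 : FractionalIdeal (𝓞 K)⁰ K) (FractionalIdeal.coeIdeal_ne_zero.mpr h0))⁻¹ L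

lemma smul_invSMul (h0 : 𝔭 ≠ ⊥) (L : Submodule (𝓞 K) (KHat2 K)) : 𝔭 • invSMul 𝔭 h0 L = L := by
  rw [← idealSMul_mk0 (FractionalIdeal.coeIdeal_ne_zero.mpr h0), invSMul, ← idealSMul_mul,
    mul_inv_cancel, idealSMul_one]

lemma invSMul_smul (h0 : 𝔭 ≠ ⊥) (L : Submodule (𝓞 K) (KHat2 K)) : invSMul 𝔭 h0 (𝔭 • L) = L := by
  rw [← idealSMul_mk0 (FractionalIdeal.coeIdeal_ne_zero.mpr h0), invSMul, ← idealSMul_mul,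
    inv_mul_cancel, idealSMul_one]

lemma le_invSMul_iff (h0 : 𝔭 ≠ ⊥) : N ≤ invSMul 𝔭 h0 L ↔ 𝔭 • N ≤ L := by
  constructor
  · intro h
    rw [← smul_invSMul h0 L]
    exact Submodule.smul_mono le_rfl h
  · intro h
    rw [← invSMul_smul h0 N]
    exact idealSMul_mono h

/-- Thus `𝔭⁻¹L / L` is the `𝔭`-torsion of `K̂² / L`. -/
lemma mem_invSMul_iff (h0 : 𝔭 ≠ ⊥) {x : KHat2 K} :
    x ∈ invSMul 𝔭 h0 L ↔ ∀ r ∈ 𝔭, r • x ∈ L := by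
  rw [← Submodule.span_singleton_le_iff_mem, le_invSMul_iff, Submodule.smul_le]
  constructor
  · exact fun h r hr => h r hr x (Submodule.mem_span_singleton_self x)
  · rintro h r hr y hy
    obtain ⟨s, rfl⟩ := Submodule.mem_span_singleton.mp hy
    rw [smul_comm]
    exact L.smul_mem s (h r hr)

lemma le_invSMul (h0 : 𝔭 ≠ ⊥) (L : Submodule (𝓞 K) (KHat2 K)) : L ≤ invSMul 𝔭 h0 L :=
  (le_invSMul_iff h0).mpr Submodule.smul_le_right

lemma IsOKLattice.invSMul (hL : IsOKLattice L) (h0 : 𝔭 ≠ ⊥) : IsOKLattice (invSMul 𝔭 h0 L) :=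
  hL.idealSMul _

lemma IsOKLattice.idx_invSMul (hL : IsOKLattice L) (hp : 𝔭.IsPrime) (h0 : 𝔭 ≠ ⊥) :
    idx L (LatticeHecke.invSMul 𝔭 h0 L) = Ideal.absNorm 𝔭 ^ 2 := by
  have h := (hL.invSMul h0).idx_smul hp h0
  rwa [smul_invSMul] at h

/-- A quotient of index ideal `𝔭` is killed by `𝔭`, which places `R` inside `𝔭⁻¹L`; conversely, such
an `R` is a lattice and cardinality decides. -/
lemma hasIndexIdeal_prime_iff (hL : IsOKLattice L) (hp : 𝔭.IsPrime) (h0 : 𝔭 ≠ ⊥) :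
    HasIndexIdeal R L 𝔭 ↔ L ≤ R ∧ R ≤ invSMul 𝔭 h0 L ∧ idx L R = Ideal.absNorm 𝔭 := by
  constructor
  · intro h
    exact ⟨h.le, (le_invSMul_iff h0).mpr (Submodule.smul_le.mpr fun r hr x hx => h.smul_mem hr hx),
      h.idx_eq⟩
  · rintro ⟨h1, h2, h3⟩
    have h4 := hasIndexIdeal_pow_iff (L := L) (k := 1) (hL.of_between (hL.invSMul h0) h1 h2) hp h0
    rw [pow_one, pow_one] at h4
    exact h4.mpr ⟨h1, ⟨1, by rwa [pow_one, ← le_invSMul_iff h0]⟩, h3⟩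

lemma hasIndexIdeal_sup_span (hL : IsOKLattice L) (hp : 𝔭.IsPrime) (h0 : 𝔭 ≠ ⊥) {x : KHat2 K}
    (hx : x ∉ L) (hpx : x ∈ invSMul 𝔭 h0 L) :
    HasIndexIdeal (L ⊔ Submodule.span (𝓞 K) {x}) L 𝔭 :=
  (hasIndexIdeal_prime_iff hL hp h0).mpr ⟨le_sup_left, sup_le (le_invSMul h0 L)
    ((Submodule.span_singleton_le_iff_mem _ _).mpr hpx),
    idx_sup_span hp h0 hx ((mem_invSMul_iff h0).mp hpx)⟩

/-- These superlattices correspond to the lines of the plane `𝔭⁻¹L / L`. -/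
lemma ncard_hasIndexIdeal_prime (hL : IsOKLattice L) (hp : 𝔭.IsPrime) (h0 : 𝔭 ≠ ⊥) :
    {R | HasIndexIdeal R L 𝔭}.ncard = Ideal.absNorm 𝔭 + 1 := by
  set P := invSMul 𝔭 h0 L with hP
  have hLP : L ≤ P := le_invSMul h0 L
  have hQ : ∀ r ∈ 𝔭, ∀ q : RelQuot P L, r • q = 0 := by
    intro r hr q
    obtain ⟨⟨x, hx⟩, rfl⟩ := Submodule.Quotient.mk_surjective _ q
    rw [← Submodule.Quotient.mk_smul, Submodule.Quotient.mk_eq_zero]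
    exact (mem_invSMul_iff h0).mp hx r hr
  have hcard : Nat.card (RelQuot P L) = Ideal.absNorm 𝔭 ^ 2 := hL.idx_invSMul hp h0
  rw [← ncard_lines hp h0 hQ hcard]
  let f : Submodule (𝓞 K) (RelQuot P L) → Submodule (𝓞 K) (KHat2 K) :=
    fun W => (W.comap (L.submoduleOf P).mkQ).map P.subtype
  have hf : Function.Injective f :=
    (Submodule.map_injective_of_injective P.injective_subtype).comp
      (Submodule.comap_injective_of_surjective (Submodule.mkQ_surjective _))
  have hfP : ∀ W, f W ≤ P := fun W => Submodule.map_subtype_le _ _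
  have hmem : ∀ W, ∀ x : P, (x : KHat2 K) ∈ f W ↔ (Submodule.Quotient.mk x : RelQuot P L) ∈ W := by
    refine fun W x => ⟨?_, fun hx => ⟨x, hx, rfl⟩⟩
    rintro ⟨y, hy, hyx⟩
    rw [← Subtype.ext hyx]
    exact hy
  have hLf : ∀ W, L ≤ f W := fun W x hx => by
    have h1 : (Submodule.Quotient.mk ⟨x, hLP hx⟩ : RelQuot P L) = 0 :=
      (Submodule.Quotient.mk_eq_zero _).mpr hx
    exact (hmem W ⟨x, hLP hx⟩).mpr (h1 ▸ W.zero_mem)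
  have hidx : ∀ W, idx L (f W) = Nat.card W := fun W => by
    let g : f W →ₗ[𝓞 K] W := ((L.submoduleOf P).mkQ.comp (Submodule.inclusion (hfP W))).codRestrict W
      fun x => (hmem W ⟨x, hfP W x.2⟩).mp x.2
    obtain ⟨e⟩ := relQuot_equiv_of_surjective (L := L) g (fun w => by
      obtain ⟨x, hx⟩ := Submodule.Quotient.mk_surjective _ w.1
      exact ⟨⟨x, (hmem W x).mpr (hx ▸ w.2)⟩, Subtype.ext hx⟩) (fun x => by
      rw [← Subtype.coe_inj]
      exact Submodule.Quotient.mk_eq_zero _)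
    exact Nat.card_congr e.toEquiv
  rw [← Set.ncard_image_of_injective _ hf]
  congr 1
  ext R
  rw [Set.mem_ofPred_eq, hasIndexIdeal_prime_iff hL hp h0]
  constructor
  · rintro ⟨h1, h2, h3⟩
    have hR : f ((R.submoduleOf P).map (L.submoduleOf P).mkQ) = R := by
      have h4 : L.submoduleOf P ⊔ R.submoduleOf P = R.submoduleOf P :=
        sup_eq_right.mpr fun x hx => h1 hx
      change Submodule.map _ (Submodule.comap _ _) = R
      rw [Submodule.comap_map_mkQ, h4, Submodule.submoduleOf, Submodule.map_comap_subtype]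
      exact inf_eq_right.mpr h2
    exact ⟨_, by rw [Set.mem_ofPred_eq, ← hidx, hR, h3], hR⟩
  · rintro ⟨W, hW, rfl⟩
    exact ⟨hLf W, hfP W, (hidx W).trans hW⟩

/-- In the descending chain `𝔭ᵏM`, take the last term not contained in `L`: its product with `𝔭` is
contained in `L`. -/
lemma exists_mem_invSMul (h0 : 𝔭 ≠ ⊥) {m : ℕ} (hm : 𝔭 ^ m • M ≤ L) (h : ¬ M ≤ L) :
    ∃ x ∈ M, x ∉ L ∧ x ∈ invSMul 𝔭 h0 L := by
  induction m with
  | zero => exact absurd (by simpa using hm) h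
  | succ m ih =>
    by_cases h1 : 𝔭 ^ m • M ≤ L
    · exact ih h1
    · obtain ⟨x, hx, hxL⟩ := SetLike.not_le_iff_exists.mp h1
      refine ⟨x, Submodule.smul_le_right hx, hxL, ?_⟩
      refine ((le_invSMul_iff h0).mpr ?_) hx
      rwa [← Submodule.mul_smul, ← pow_succ']

/-- The number of superlattices of `L` of prime index `𝔭` contained in a given superlattice `M`
of index a power of `𝔭`. -/
lemma ncard_hasIndexIdeal_prime_le (hL : IsOKLattice L) (hp : 𝔭.IsPrime)
    (h0 : 𝔭 ≠ ⊥) {n : ℕ} (h : HasIndexIdeal M L (𝔭 ^ (n + 1))) [Decidable (invSMul 𝔭 h0 L ≤ M)] :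
    {R | HasIndexIdeal R L 𝔭 ∧ R ≤ M}.ncard =
      if invSMul 𝔭 h0 L ≤ M then Ideal.absNorm 𝔭 + 1 else 1 := by
  have hN := one_lt_absNorm hp h0
  split_ifs with hPM
  · rw [← ncard_hasIndexIdeal_prime hL hp h0]
    congr 1
    ext R
    exact and_iff_left_of_imp fun hR => ((hasIndexIdeal_prime_iff hL hp h0).mp hR).2.1.trans hPM
  -- The exponent `n + 1` is positive, so `M ≠ L` and at least one line of `𝔭⁻¹L / L` lies in `M /
  -- L`.
  · obtain ⟨x, hxM, hxL, hxP⟩ := exists_mem_invSMul h0 (M := M) (L := L) (m := n + 1)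
      (Submodule.smul_le.mpr fun r hr x hx => h.smul_mem hr hx) (fun hML => by
        have h1 := h.idx_eq
        rw [le_antisymm hML h.le, idx_self, map_pow] at h1
        exact absurd h1 (Nat.one_lt_pow (Nat.succ_ne_zero n) hN).ne)
    have hx := hasIndexIdeal_sup_span hL hp h0 hxL hxP
    set R₀ := L ⊔ Submodule.span (𝓞 K) {x} with hR₀
    have hR₀M : R₀ ≤ M := sup_le h.le ((Submodule.span_singleton_le_iff_mem _ _).mpr hxM)
    rw [Set.ncard_eq_one]
    refine ⟨R₀, Set.eq_singleton_iff_unique_mem.mpr ⟨⟨hx, hR₀M⟩, ?_⟩⟩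
    rintro R ⟨hR, hRM⟩
    have hRP := ((hasIndexIdeal_prime_iff hL hp h0).mp hR).2.1
    have hR₀P := ((hasIndexIdeal_prime_iff hL hp h0).mp hx).2.1
    by_contra hne
    have hRR : ¬ R ≤ R₀ := fun hle => hne (eq_of_idx_eq hR.le hle (hR.idx_eq.trans hx.idx_eq.symm)
      (by rw [hx.idx_eq]; omega))
    obtain ⟨y, hyR, hyR₀⟩ := SetLike.not_le_iff_exists.mp hRR
    have h1 := idx_sup_span hp h0 hyR₀ fun r hr => hx.le (hR.smul_mem hr hyR)
    have hy : Submodule.span (𝓞 K) {y} ≤ R := (Submodule.span_singleton_le_iff_mem _ _).mpr hyR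
    -- A second line `R` would span the whole plane together with `R₀`, forcing `𝔭⁻¹L ⊆ M`.
    have h2 : R₀ ⊔ Submodule.span (𝓞 K) {y} = invSMul 𝔭 h0 L := by
      refine eq_of_idx_eq (L := L) (hx.le.trans le_sup_left) (sup_le hR₀P (hy.trans hRP)) ?_ ?_
      · rw [← idx_mul_idx hx.le le_sup_left, h1, hx.idx_eq, hL.idx_invSMul hp h0, sq]
      · rw [hL.idx_invSMul hp h0]; positivity
    exact hPM (h2 ▸ sup_le hR₀M (hy.trans hRM))

/-- Among lattices, the index ideal is multiplicative for powers of a prime. -/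
lemma HasIndexIdeal.pow_mul (hM : IsOKLattice M) (hp : 𝔭.IsPrime) (h0 : 𝔭 ≠ ⊥) {i j : ℕ}
    (h₁ : HasIndexIdeal N L (𝔭 ^ i)) (h₂ : HasIndexIdeal M N (𝔭 ^ j)) :
    HasIndexIdeal M L (𝔭 ^ (i + j)) := by
  refine (hasIndexIdeal_pow_iff hM hp h0).mpr ⟨h₁.le.trans h₂.le, ⟨i + j, ?_⟩, ?_⟩
  · rw [pow_add, Submodule.mul_smul]
    have h3 : 𝔭 ^ j • M ≤ N := Submodule.smul_le.mpr fun r hr x hx => h₂.smul_mem hr hx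
    have h4 : 𝔭 ^ i • N ≤ L := Submodule.smul_le.mpr fun r hr x hx => h₁.smul_mem hr hx
    exact (Submodule.smul_mono le_rfl h3).trans h4
  · rw [← idx_mul_idx h₁.le h₂.le, h₁.idx_eq, h₂.idx_eq, map_pow, map_pow, pow_add]

/-- As a power of `𝔭` kills `M / N`, cardinalities decide, and they can be divided. -/
lemma HasIndexIdeal.of_pow_add (hM : IsOKLattice M) (hp : 𝔭.IsPrime) (h0 : 𝔭 ≠ ⊥) {i j : ℕ}
    (hLN : L ≤ N) (hNM : N ≤ M) (hN : idx L N = Ideal.absNorm 𝔭 ^ i)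
    (h : HasIndexIdeal M L (𝔭 ^ (i + j))) : HasIndexIdeal M N (𝔭 ^ j) := by
  refine (hasIndexIdeal_pow_iff hM hp h0).mpr ⟨hNM, ⟨i + j, ?_⟩, ?_⟩
  · exact (Submodule.smul_le.mpr fun r hr x hx => h.smul_mem hr hx).trans hLN
  · have h1 := idx_mul_idx hLN hNM
    rw [h.idx_eq, hN, map_pow, pow_add] at h1
    exact Nat.eq_of_mul_eq_mul_left (pow_pos (by have := one_lt_absNorm hp h0; omega) i) h1

end PrimeIndex
/-! ### Hecke operators on abstract systems of lattices -/

/-- A set `X` of lattices with extra structure that is transported along inclusions and along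
multiplication by fractional ideals coprime to `𝔫`. It axiomatizes what modular points for `Γ₀(𝔫)`
and for `Γ₁(𝔫)` have in common: `Q` lies above `P` if the structure of `P` induces that of `Q`. -/
structure HeckeSystem (𝔫 : Ideal (𝓞 K)) (X : Type*) where
  lat : X → Submodule (𝓞 K) (KHat2 K)
  isLattice : ∀ P, IsOKLattice (lat P)
  le : X → X → Prop
  le_refl : ∀ P, le P P
  le_trans : ∀ {P Q R}, le P Q → le Q R → le P R
  lat_mono : ∀ {P Q}, le P Q → lat P ≤ lat Q
  le_of_lat_le : ∀ {P Q R}, le P Q → le P R → lat Q ≤ lat R → le Q R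
  eq_of_lat_eq : ∀ {P Q R}, le P Q → le P R → lat Q = lat R → Q = R
  exists_between : ∀ {P Q N}, le P Q → lat P ≤ N → N ≤ lat Q → ∃ R, le P R ∧ lat R = N
  scale : coprimeIdeals 𝔫 → X → X
  scale_one : ∀ P, scale 1 P = P
  scale_mul : ∀ 𝔞 𝔟 P, scale (𝔞 * 𝔟) P = scale 𝔞 (scale 𝔟 P)
  lat_scale : ∀ 𝔞 P, lat (scale 𝔞 P) = idealSMul (𝔞 : (FractionalIdeal (𝓞 K)⁰ K)ˣ)⁻¹ (lat P)
  scale_mono : ∀ 𝔞 {P Q}, le P Q → le (scale 𝔞 P) (scale 𝔞 Q)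
  le_scale : ∀ {𝔭} (hp : 𝔭.IsPrime) (h0 : 𝔭 ≠ ⊥) (hn : ¬ 𝔭 ∣ 𝔫) P,
    le P (scale (primeToLevel 𝔭 hp h0 hn) P)
  -- This axiom and `le_scale` are where the two cases `𝔭 ∣ 𝔫` and `𝔭 ∤ 𝔫` part.
  not_invSMul_le : ∀ {𝔭}, 𝔭.IsPrime → ∀ h0 : 𝔭 ≠ ⊥, 𝔭 ∣ 𝔫 → ∀ {P Q}, le P Q →
    ¬ invSMul 𝔭 h0 (lat P) ≤ lat Q

namespace HeckeSystem

variable {𝔫 : Ideal (𝓞 K)} {X : Type*} (H : HeckeSystem 𝔫 X) {𝔞 𝔟 𝔠 𝔭 : Ideal (𝓞 K)} {P Q R : X}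

/-- The points above `P` whose lattice has index ideal `𝔞` over that of `P`. -/
def above (𝔞 : Ideal (𝓞 K)) (P : X) : Set X :=
  {Q | H.le P Q ∧ HasIndexIdeal (H.lat Q) (H.lat P) 𝔞}

/-- The operator `T_𝔞`. -/
def T (𝔞 : Ideal (𝓞 K)) : Module.End ℚ (X →₀ ℚ) :=
  Finsupp.linearCombination ℚ fun P =>
    (Ideal.absNorm 𝔞 : ℚ)⁻¹ • ∑ᶠ Q ∈ H.above 𝔞 P, Finsupp.single Q 1

/-- The operator `T_{𝔞,𝔞}`. -/
def S (𝔞 : coprimeIdeals 𝔫) : Module.End ℚ (X →₀ ℚ) :=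
  Finsupp.linearCombination ℚ fun P =>
    Finsupp.single (H.scale 𝔞 P) ((FractionalIdeal.absNorm
      ((𝔞 : (FractionalIdeal (𝓞 K)⁰ K)ˣ) : FractionalIdeal (𝓞 K)⁰ K) ^ 2)⁻¹)

lemma finite_above (h0 : 𝔞 ≠ ⊥) (P : X) : (H.above 𝔞 P).Finite := by
  refine Set.Finite.of_finite_image (f := H.lat)
    ((finite_hasIndexIdeal (H.isLattice P).fg h0).subset ?_) fun Q hQ R hR h =>
      H.eq_of_lat_eq hQ.1 hR.1 h
  rintro _ ⟨Q, hQ, rfl⟩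
  exact hQ.2

/-- The finite set of points above `P` with index ideal `𝔞`. -/
def aboveFinset (h0 : 𝔞 ≠ ⊥) (P : X) : Finset X := (H.finite_above h0 P).toFinset

lemma mem_aboveFinset {h0 : 𝔞 ≠ ⊥} :
    Q ∈ H.aboveFinset h0 P ↔ H.le P Q ∧ HasIndexIdeal (H.lat Q) (H.lat P) 𝔞 :=
  (H.finite_above h0 P).mem_toFinset

lemma T_single (h0 : 𝔞 ≠ ⊥) (P : X) : H.T 𝔞 (Finsupp.single P 1) =
    (Ideal.absNorm 𝔞 : ℚ)⁻¹ • ∑ Q ∈ H.aboveFinset h0 P, Finsupp.single Q 1 := by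
  rw [T, Finsupp.linearCombination_single, one_smul,
    finsum_mem_eq_finite_toFinset_sum _ (H.finite_above h0 P)]
  rfl

lemma S_single (𝔞 : coprimeIdeals 𝔫) (P : X) : H.S 𝔞 (Finsupp.single P 1) =
    (FractionalIdeal.absNorm ((𝔞 : (FractionalIdeal (𝓞 K)⁰ K)ˣ) :
      FractionalIdeal (𝓞 K)⁰ K) ^ 2)⁻¹ • Finsupp.single (H.scale 𝔞 P) 1 := by
  rw [S, Finsupp.linearCombination_single, one_smul, Finsupp.smul_single_one]

lemma end_ext {f g : Module.End ℚ (X →₀ ℚ)}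
    (h : ∀ P, f (Finsupp.single P 1) = g (Finsupp.single P 1)) : f = g :=
  Finsupp.lhom_ext' fun P => LinearMap.ext_ring (h P)

theorem T_top : H.T ⊤ = 1 := by
  refine end_ext fun P => ?_
  have h1 : H.aboveFinset (𝔞 := ⊤) top_ne_bot P = {P} := by
    ext Q
    rw [mem_aboveFinset, Finset.mem_singleton]
    constructor
    · rintro ⟨h, h'⟩
      exact H.eq_of_lat_eq h (H.le_refl P) h'.eq_of_top
    · rintro rfl
      exact ⟨H.le_refl _, hasIndexIdeal_self _⟩
  rw [H.T_single top_ne_bot, h1, Ideal.absNorm_top, Nat.cast_one, inv_one, one_smul,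
    Finset.sum_singleton, Module.End.one_apply]

theorem S_one : H.S 1 = 1 := by
  refine end_ext fun P => ?_
  rw [S_single, H.scale_one, Module.End.one_apply]
  simp

theorem S_mul_S (𝔞 𝔟 : coprimeIdeals 𝔫) : H.S 𝔞 * H.S 𝔟 = H.S (𝔞 * 𝔟) := by
  refine end_ext fun P => ?_
  rw [Module.End.mul_apply, S_single, map_smul, S_single, S_single, H.scale_mul, smul_smul,
    Subgroup.coe_mul, Units.val_mul, map_mul, mul_pow, mul_inv, mul_comm]

lemma scale_inv_scale (𝔞 : coprimeIdeals 𝔫) (P : X) : H.scale 𝔞⁻¹ (H.scale 𝔞 P) = P := by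
  rw [← H.scale_mul, inv_mul_cancel, H.scale_one]

lemma scale_mem_aboveFinset (𝔞 : coprimeIdeals 𝔫) {h0 : 𝔟 ≠ ⊥} (h : Q ∈ H.aboveFinset h0 P) :
    H.scale 𝔞 Q ∈ H.aboveFinset h0 (H.scale 𝔞 P) := by
  rw [mem_aboveFinset] at h ⊢
  rw [H.lat_scale, H.lat_scale]
  exact ⟨H.scale_mono 𝔞 h.1, h.2.idealSMul h0 _⟩

/-- Scaling preserves index ideals and is inverted by scaling with the inverse ideal, so it is a
bijection from the points above `P` to those above the scaled `P`. -/
theorem S_mul_T (𝔞 : coprimeIdeals 𝔫) (h0 : 𝔟 ≠ ⊥) : H.S 𝔞 * H.T 𝔟 = H.T 𝔟 * H.S 𝔞 := by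
  refine end_ext fun P => ?_
  simp only [Module.End.mul_apply, S_single, H.T_single h0, map_smul, map_sum, ← Finset.smul_sum]
  rw [smul_comm]
  congr 2
  refine Finset.sum_bij' (fun Q _ => H.scale 𝔞 Q) (fun Q _ => H.scale 𝔞⁻¹ Q)
    (fun Q hQ => H.scale_mem_aboveFinset 𝔞 hQ) (fun Q hQ => ?_)
    (fun Q _ => H.scale_inv_scale 𝔞 Q) (fun Q _ => ?_) (fun _ _ => rfl)
  · have h := H.scale_mem_aboveFinset 𝔞⁻¹ hQ
    rwa [scale_inv_scale] at h
  · have h := H.scale_inv_scale 𝔞⁻¹ Q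
    rwa [inv_inv] at h

/-- A lattice between those of `P` and `Q` carries exactly one point above `P`, and that point lies
below `Q`. Counting points thus becomes counting lattices. -/
lemma card_filter_le (h0 : 𝔟 ≠ ⊥) (h : H.le P Q) [DecidablePred fun R => H.le R Q] :
    ((H.aboveFinset h0 P).filter fun R => H.le R Q).card =
      {N | HasIndexIdeal N (H.lat P) 𝔟 ∧ N ≤ H.lat Q}.ncard := by
  rw [← Set.ncard_coe_finset, ← Set.InjOn.ncard_image (f := H.lat)]
  · congr 1
    ext N
    constructor
    · rintro ⟨R, hR, rfl⟩
      rw [Finset.mem_coe, Finset.mem_filter, mem_aboveFinset] at hR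
      exact ⟨hR.1.2, H.lat_mono hR.2⟩
    · rintro ⟨hN, hNQ⟩
      obtain ⟨R, hR, rfl⟩ := H.exists_between h hN.le hNQ
      refine ⟨R, ?_, rfl⟩
      rw [Finset.mem_coe, Finset.mem_filter, mem_aboveFinset]
      exact ⟨⟨hR, hN⟩, H.le_of_lat_le hR h hNQ⟩
  · intro R hR R' hR' hRR
    rw [Finset.mem_coe, Finset.mem_filter, mem_aboveFinset] at hR hR'
    exact H.eq_of_lat_eq hR.1.1 hR'.1.1 hRR

/-- If index ideals multiply as they should, then the coefficients of `T_𝔞 T_𝔟` count intermediate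
lattices. -/
lemma T_mul_T_single (ha : 𝔞 ≠ ⊥) (hb : 𝔟 ≠ ⊥)
    (hmul : ∀ {L N M : Submodule (𝓞 K) (KHat2 K)}, IsOKLattice L → IsOKLattice M →
      HasIndexIdeal N L 𝔟 → N ≤ M → (HasIndexIdeal M N 𝔞 ↔ HasIndexIdeal M L (𝔞 * 𝔟))) (P : X) :
    (H.T 𝔞 * H.T 𝔟) (Finsupp.single P 1) = (Ideal.absNorm (𝔞 * 𝔟) : ℚ)⁻¹ •
      ∑ Q ∈ H.aboveFinset (mul_ne_zero ha hb) P,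
        ({N | HasIndexIdeal N (H.lat P) 𝔟 ∧ N ≤ H.lat Q}.ncard : ℚ) • Finsupp.single Q 1 := by
  classical
  simp only [Module.End.mul_apply, H.T_single hb, H.T_single ha, map_smul, map_sum,
    ← Finset.smul_sum, smul_smul, map_mul, Nat.cast_mul, mul_inv]
  rw [mul_comm (Ideal.absNorm 𝔟 : ℚ)⁻¹]
  congr 1
  -- Exchange the sums: first choose the top point `Q`, then the intermediate `R`. By `hmul`, the
  -- condition on `[M : N]` becomes one on `[M : L]`, independent of `R`.
  rw [Finset.sum_comm' (s' := fun Q => (H.aboveFinset hb P).filter fun R => H.le R Q)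
    (t' := H.aboveFinset (mul_ne_zero ha hb) P)]
  · refine Finset.sum_congr rfl fun Q hQ => ?_
    rw [Finset.sum_const, H.card_filter_le hb (H.mem_aboveFinset.mp hQ).1, Nat.cast_smul_eq_nsmul]
  · intro R Q
    simp only [Finset.mem_filter, mem_aboveFinset]
    constructor
    · rintro ⟨⟨h1, h2⟩, h3, h4⟩
      exact ⟨⟨⟨h1, h2⟩, h3⟩, H.le_trans h1 h3,
        (hmul (H.isLattice P) (H.isLattice Q) h2 h4.le).mp h4⟩
    · rintro ⟨⟨⟨h1, h2⟩, h3⟩, h4, h5⟩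
      exact ⟨⟨h1, h2⟩, h3, (hmul (H.isLattice P) (H.isLattice Q) h2 (H.lat_mono h3)).mpr h5⟩

theorem T_mul_T_of_isCoprime (ha : 𝔞 ≠ ⊥) (hb : 𝔟 ≠ ⊥) (h : IsCoprime 𝔞 𝔟) :
    H.T 𝔞 * H.T 𝔟 = H.T (𝔞 * 𝔟) := by
  refine end_ext fun P => ?_
  rw [H.T_mul_T_single ha hb, H.T_single (mul_ne_zero ha hb)]
  · congr 1
    refine Finset.sum_congr rfl fun Q hQ => ?_
    obtain ⟨N, hN, hN'⟩ := (H.mem_aboveFinset.mp hQ).2.exists_between h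
    have h1 : {N | HasIndexIdeal N (H.lat P) 𝔟 ∧ N ≤ H.lat Q} = {N} :=
      Set.eq_singleton_iff_unique_mem.mpr ⟨⟨hN, hN'.le⟩, fun M hM => hN.eq_of_le hN' h hb hM.1 hM.2⟩
    rw [h1, Set.ncard_singleton, Nat.cast_one, one_smul]
  · intro L N M _ _ hN hNM
    refine ⟨fun hM => hN.mul hM h, fun hM => ?_⟩
    obtain ⟨N₀, h1, h2⟩ := hM.exists_between h
    rwa [h1.eq_of_le h2 h hb hN hNM]

open Classical in
lemma T_pow_mul_T_single (hp : 𝔭.IsPrime) (h0 : 𝔭 ≠ ⊥) (n : ℕ) (P : X) :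
    (H.T (𝔭 ^ n) * H.T 𝔭) (Finsupp.single P 1) = (Ideal.absNorm (𝔭 ^ (n + 1)) : ℚ)⁻¹ •
      ∑ Q ∈ H.aboveFinset (pow_ne_zero (n + 1) h0) P,
        (if invSMul 𝔭 h0 (H.lat P) ≤ H.lat Q then (Ideal.absNorm 𝔭 + 1 : ℚ) else 1) •
          Finsupp.single Q 1 := by
  rw [H.T_mul_T_single (pow_ne_zero n h0) h0]
  · simp only [← pow_succ]
    congr 1
    refine Finset.sum_congr rfl fun Q hQ => ?_
    rw [ncard_hasIndexIdeal_prime_le (H.isLattice P) hp h0 (H.mem_aboveFinset.mp hQ).2]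
    split_ifs <;> simp
  · intro L N M _ hM hN hNM
    rw [← pow_succ, add_comm n 1]
    refine ⟨fun h => ?_, fun h => h.of_pow_add hM hp h0 hN.le hNM ?_⟩
    · exact HasIndexIdeal.pow_mul hM hp h0 (by rwa [pow_one]) h
    · rw [hN.idx_eq, pow_one]

theorem T_pow_mul_T_of_dvd (hp : 𝔭.IsPrime) (h0 : 𝔭 ≠ ⊥) (hn : 𝔭 ∣ 𝔫) (n : ℕ) :
    H.T (𝔭 ^ n) * H.T 𝔭 = H.T (𝔭 ^ (n + 1)) := by
  classical
  refine end_ext fun P => ?_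
  rw [H.T_pow_mul_T_single hp h0, H.T_single (pow_ne_zero (n + 1) h0)]
  congr 1
  refine Finset.sum_congr rfl fun Q hQ => ?_
  rw [if_neg (H.not_invSMul_le hp h0 hn (H.mem_aboveFinset.mp hQ).1), one_smul]

theorem T_pow_of_dvd (hp : 𝔭.IsPrime) (h0 : 𝔭 ≠ ⊥) (hn : 𝔭 ∣ 𝔫) (n : ℕ) :
    H.T (𝔭 ^ n) = H.T 𝔭 ^ n := by
  induction n with
  | zero => rw [pow_zero, pow_zero, Ideal.one_eq_top, T_top]
  | succ n ih => rw [← H.T_pow_mul_T_of_dvd hp h0 hn, ih, pow_succ]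

-- Since `[𝔭⁻¹L : L] = 𝔭²`, passing to the scaled point lowers the exponent by two; the relation to
-- `Q` comes from `le_of_lat_le`.
open Classical in
lemma aboveFinset_scale (hp : 𝔭.IsPrime) (h0 : 𝔭 ≠ ⊥) (hn : ¬ 𝔭 ∣ 𝔫) (n : ℕ) (P : X) :
    H.aboveFinset (pow_ne_zero n h0) (H.scale (primeToLevel 𝔭 hp h0 hn) P) =
      (H.aboveFinset (pow_ne_zero (n + 2) h0) P).filter
        fun Q => invSMul 𝔭 h0 (H.lat P) ≤ H.lat Q := by
  have hlat : H.lat (H.scale (primeToLevel 𝔭 hp h0 hn) P) = invSMul 𝔭 h0 (H.lat P) :=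
    H.lat_scale _ _
  have hle := H.le_scale hp h0 hn P
  have hL := H.isLattice P
  have hidx := hL.idx_invSMul hp h0
  have hle' := le_invSMul h0 (H.lat P)
  have hindex : HasIndexIdeal (invSMul 𝔭 h0 (H.lat P)) (H.lat P) (𝔭 ^ 2) :=
    (hasIndexIdeal_pow_iff (hL.invSMul h0) hp h0).mpr ⟨hle', ⟨1, by
      rw [pow_one, smul_invSMul]⟩, hidx⟩
  ext Q
  rw [Finset.mem_filter, mem_aboveFinset, mem_aboveFinset, add_comm n 2, hlat]
  constructor
  · rintro ⟨h1, h2⟩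
    exact ⟨⟨H.le_trans hle h1, hindex.pow_mul (H.isLattice Q) hp h0 h2⟩, h2.le⟩
  · rintro ⟨⟨h1, h2⟩, h3⟩
    exact ⟨H.le_of_lat_le hle h1 (hlat ▸ h3), h2.of_pow_add (H.isLattice Q) hp h0 hle' h3 hidx⟩

/-- On the points whose lattice contains `𝔭⁻¹L` the coefficient is `1 + N(𝔭)`: the `1` belongs to
`T_{𝔭ⁿ⁺²}`, and the `N(𝔭)` to the points above the scaled point. -/
theorem T_pow_mul_T (hp : 𝔭.IsPrime) (h0 : 𝔭 ≠ ⊥) (hn : ¬ 𝔭 ∣ 𝔫) (n : ℕ) :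
    H.T (𝔭 ^ (n + 1)) * H.T 𝔭 = H.T (𝔭 ^ (n + 2)) +
      (Ideal.absNorm 𝔭 : ℚ) • (H.T (𝔭 ^ n) * H.S (primeToLevel 𝔭 hp h0 hn)) := by
  classical
  refine end_ext fun P => ?_
  have hN : (Ideal.absNorm 𝔭 : ℚ) ≠ 0 := by
    have := one_lt_absNorm hp h0
    positivity
  have habs : FractionalIdeal.absNorm (((primeToLevel 𝔭 hp h0 hn : coprimeIdeals 𝔫) :
      (FractionalIdeal (𝓞 K)⁰ K)ˣ) : FractionalIdeal (𝓞 K)⁰ K) = (Ideal.absNorm 𝔭 : ℚ) :=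
    FractionalIdeal.coeIdeal_absNorm 𝔭
  rw [H.T_pow_mul_T_single hp h0, LinearMap.add_apply, LinearMap.smul_apply,
    H.T_single (pow_ne_zero (n + 2) h0), Module.End.mul_apply, S_single, map_smul,
    H.T_single (pow_ne_zero n h0), H.aboveFinset_scale, Finset.sum_filter, habs, smul_smul,
    smul_smul]
  -- The normalizations agree: `N(𝔭) · N(𝔭)⁻² · N(𝔭)⁻ⁿ = N(𝔭)⁻⁽ⁿ⁺²⁾ · N(𝔭)`.
  have hc : (Ideal.absNorm 𝔭 : ℚ) * (((Ideal.absNorm 𝔭 : ℚ) ^ 2)⁻¹ *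
      (Ideal.absNorm (𝔭 ^ n) : ℚ)⁻¹) =
        (Ideal.absNorm (𝔭 ^ (n + 2)) : ℚ)⁻¹ * (Ideal.absNorm 𝔭 : ℚ) := by
    rw [map_pow, map_pow]
    push_cast
    field_simp
    ring
  rw [mul_assoc, hc, ← smul_smul, ← smul_add]
  congr 1
  rw [Finset.smul_sum, ← Finset.sum_add_distrib]
  refine Finset.sum_congr rfl fun Q _ => ?_
  split_ifs
  · rw [add_smul, one_smul, add_comm]
  · rw [one_smul, smul_zero, add_zero]

end HeckeSystem

/-! ### Modular points form Hecke systems -/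

section Points

variable {𝔫 : Ideal (𝓞 K)}

lemma le_idealSMul_inv {𝔭 : Ideal (𝓞 K)} (hp : 𝔭.IsPrime) (h0 : 𝔭 ≠ ⊥) (hn : ¬ 𝔭 ∣ 𝔫)
    (L : Submodule (𝓞 K) (KHat2 K)) : L ≤ idealSMul
      ((primeToLevel 𝔭 hp h0 hn : coprimeIdeals 𝔫) : (FractionalIdeal (𝓞 K)⁰ K)ˣ)⁻¹ L :=
  le_invSMul h0 L

/-! ### Points for `Γ₀(𝔫)` -/

namespace ModularPoint0

/-- The relation that `Q` lies above `P`: it is of the form `(M, M + L')` for `P = (L, L')`. -/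
def Below (P Q : ModularPoint0 𝔫) : Prop := P.L ≤ Q.L ∧ Q.L' = Q.L ⊔ P.L'

lemma Below.refl (P : ModularPoint0 𝔫) : P.Below P :=
  ⟨le_rfl, (sup_eq_right.mpr P.le).symm⟩

lemma Below.trans {P Q R : ModularPoint0 𝔫} (h₁ : P.Below Q) (h₂ : Q.Below R) : P.Below R :=
  ⟨h₁.1.trans h₂.1, by rw [h₂.2, h₁.2, ← sup_assoc, sup_eq_left.mpr h₂.1]⟩

lemma Below.of_le {P Q R : ModularPoint0 𝔫} (h₁ : P.Below Q) (h₂ : P.Below R) (h : Q.L ≤ R.L) :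
    Q.Below R :=
  ⟨h, by rw [h₂.2, h₁.2, ← sup_assoc, sup_eq_left.mpr h]⟩

lemma Below.eq_of_eq {P Q R : ModularPoint0 𝔫} (h₁ : P.Below Q) (h₂ : P.Below R)
    (h : Q.L = R.L) : Q = R :=
  ModularPoint0.ext h (by rw [h₁.2, h₂.2, h])

lemma Below.generator {P Q : ModularPoint0 𝔫} (h : P.Below Q) {β : KHat2 K}
    (hβ : P.L' = P.L ⊔ Submodule.span (𝓞 K) {β}) : Q.L' = Q.L ⊔ Submodule.span (𝓞 K) {β} := by
  rw [h.2, hβ, ← sup_assoc, sup_eq_left.mpr h.1]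

/-- The generator `β` has annihilator `𝔫` modulo `P.L` and modulo `Q.L`, hence modulo every lattice
between them. -/
lemma Below.exists_between {P Q : ModularPoint0 𝔫} (h : P.Below Q)
    {N : Submodule (𝓞 K) (KHat2 K)} (h₁ : P.L ≤ N) (h₂ : N ≤ Q.L) :
    ∃ R : ModularPoint0 𝔫, P.Below R ∧ R.L = N := by
  obtain ⟨β, -, hβ⟩ := exists_generator_of_quot P.le P.quot
  have hN : N ⊔ P.L' = N ⊔ Submodule.span (𝓞 K) {β} := by
    rw [hβ, ← sup_assoc, sup_eq_left.mpr h₁]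
  refine ⟨⟨N, N ⊔ P.L', P.isLattice.of_between Q.isLattice h₁ h₂,
    P.isLattice'.of_between Q.isLattice' le_sup_right ?_, le_sup_left,
    quot_of_generator hN fun r => ⟨fun hr => ?_, fun hr => h₁ ?_⟩⟩, ⟨h₁, rfl⟩, rfl⟩
  · rw [h.2]; exact sup_le_sup_right h₂ _
  · exact (smul_generator_mem_iff Q.quot (h.generator hβ) r).mp (h₂ hr)
  · exact (smul_generator_mem_iff P.quot hβ r).mpr hr

lemma Below.scale (hn : 𝔫 ≠ ⊥) (𝔟 : (FractionalIdeal (𝓞 K)⁰ K)ˣ) {P Q : ModularPoint0 𝔫}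
    (h : P.Below Q) : (P.scale hn 𝔟).Below (Q.scale hn 𝔟) := by
  refine ⟨idealSMul_mono h.1, ?_⟩
  change idealSMul 𝔟 Q.L' = idealSMul 𝔟 Q.L ⊔ idealSMul 𝔟 P.L'
  rw [h.2, idealSMul, Submodule.smul_sup]
  rfl

lemma scale_one (hn : 𝔫 ≠ ⊥) (P : ModularPoint0 𝔫) : P.scale hn 1 = P :=
  ModularPoint0.ext (idealSMul_one _) (idealSMul_one _)

lemma scale_mul (hn : 𝔫 ≠ ⊥) (𝔞 𝔟 : (FractionalIdeal (𝓞 K)⁰ K)ˣ) (P : ModularPoint0 𝔫) :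
    P.scale hn (𝔞 * 𝔟) = (P.scale hn 𝔟).scale hn 𝔞 :=
  ModularPoint0.ext (idealSMul_mul _ _ _) (idealSMul_mul _ _ _)

/-- The content is `𝔭⁻¹L' = 𝔭⁻¹L + L'`. By coprimality, `𝔭⁻¹L' / 𝔭⁻¹L` is generated by `uβ` with `u`
integral, and `uβ` lies in `L'`. -/
lemma below_scale (hn : 𝔫 ≠ ⊥) {𝔭 : Ideal (𝓞 K)} (hp : 𝔭.IsPrime) (h0 : 𝔭 ≠ ⊥)
    (hpn : ¬ 𝔭 ∣ 𝔫) (P : ModularPoint0 𝔫) : P.Below (P.scale hn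
      ((primeToLevel 𝔭 hp h0 hpn : coprimeIdeals 𝔫) : (FractionalIdeal (𝓞 K)⁰ K)ˣ)⁻¹) := by
  refine ⟨le_idealSMul_inv hp h0 hpn _, le_antisymm ?_ (sup_le (idealSMul_mono P.le)
    (le_idealSMul_inv hp h0 hpn _))⟩
  obtain ⟨β, hβ, hgen⟩ := exists_generator_of_quot P.le P.quot
  obtain ⟨u, hu, hub, y, hy, m, hm, h⟩ := exists_unit_mod (primeToLevel 𝔭 hp h0 hpn)
  have h2 := idealSMul_generator hgen (smul_generator_mem_iff P.quot hgen)
    ((primeToLevel 𝔭 hp h0 hpn : coprimeIdeals 𝔫) : (FractionalIdeal (𝓞 K)⁰ K)ˣ)⁻¹ hub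
    (by rwa [inv_inv]) hm h
  refine h2.1.le.trans (sup_le_sup_left ((Submodule.span_singleton_le_iff_mem _ _).mpr ?_) _)
  rw [algebraMap_smul]
  exact P.L'.smul_mem u hβ

/-- Write `𝔫 = 𝔭𝔠`. Then `𝔠β ⊆ 𝔭⁻¹L`, so `𝔭⁻¹L ⊆ Q.L` would put `𝔠` into the annihilator `𝔭𝔠` of `β`
modulo `Q.L`, which is impossible. -/
lemma Below.not_invSMul_le (hn : 𝔫 ≠ ⊥) {𝔭 : Ideal (𝓞 K)} (hp : 𝔭.IsPrime) (h0 : 𝔭 ≠ ⊥)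
    (hpn : 𝔭 ∣ 𝔫) {P Q : ModularPoint0 𝔫} (h : P.Below Q) : ¬ invSMul 𝔭 h0 P.L ≤ Q.L := by
  intro hle
  obtain ⟨β, -, hβ⟩ := exists_generator_of_quot P.le P.quot
  have hP := smul_generator_mem_iff P.quot hβ
  have hQ := smul_generator_mem_iff Q.quot (h.generator hβ)
  obtain ⟨𝔠, rfl⟩ := hpn
  have hc : 𝔠 ≤ 𝔭 * 𝔠 := fun r hr => (hQ r).mp (hle ((mem_invSMul_iff h0).mpr fun s hs => by
    rw [smul_smul]
    exact (hP _).mpr (Ideal.mul_mem_mul hs hr)))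
  have h1 : 𝔭 * 𝔠 ∣ 1 * 𝔠 := by rw [one_mul]; exact Ideal.dvd_iff_le.mpr hc
  have h2 := (mul_dvd_mul_iff_right (right_ne_zero_of_mul hn)).mp h1
  exact hp.ne_top (Ideal.isUnit_iff.mp (isUnit_of_dvd_one h2))

end ModularPoint0

/-! ### Points for `Γ₁(𝔫)` -/

namespace ModularPoint1

lemma coset_nonempty (P : ModularPoint1 𝔫) : P.coset.Nonempty := by
  obtain ⟨β, -, -, h⟩ := P.exists_generator
  exact ⟨β, by rw [h]; simp⟩

lemma mem_coset_iff (P : ModularPoint1 𝔫) {β : KHat2 K} (hβ : β ∈ P.coset) (x : KHat2 K) :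
    x ∈ P.coset ↔ x - β ∈ P.L := by
  obtain ⟨γ, -, -, h⟩ := P.exists_generator
  rw [h] at hβ ⊢
  change x - γ ∈ P.L ↔ x - β ∈ P.L
  rw [← sub_add_sub_cancel x β γ]
  exact Submodule.add_mem_iff_left _ hβ

lemma generator (P : ModularPoint1 𝔫) {β : KHat2 K} (hβ : β ∈ P.coset) :
    P.L' = P.L ⊔ Submodule.span (𝓞 K) {β} := by
  obtain ⟨γ, -, hγ, h⟩ := P.exists_generator
  rw [h] at hβ
  have h1 : ∀ x ∈ P.L ⊔ Submodule.span (𝓞 K) {γ}, β - γ ∈ P.L →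
      x ∈ P.L ⊔ Submodule.span (𝓞 K) {β} := by
    intro x hx h1
    obtain ⟨l, hl, z, hz, rfl⟩ := Submodule.mem_sup.mp hx
    obtain ⟨r, rfl⟩ := Submodule.mem_span_singleton.mp hz
    have e : l + r • γ = (l - r • (β - γ)) + r • β := by rw [smul_sub]; abel
    rw [e]
    exact Submodule.add_mem_sup (P.L.sub_mem hl (P.L.smul_mem r h1))
      (Submodule.smul_mem _ r (Submodule.mem_span_singleton_self β))
  refine le_antisymm (fun x hx => h1 x (hγ ▸ hx) hβ) (sup_le P.le
    ((Submodule.span_singleton_le_iff_mem _ _).mpr ?_))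
  rw [hγ, ← sub_add_cancel β γ]
  exact Submodule.add_mem_sup hβ (Submodule.mem_span_singleton_self γ)

lemma mem_of_mem_coset (P : ModularPoint1 𝔫) {β : KHat2 K} (hβ : β ∈ P.coset) : β ∈ P.L' := by
  rw [P.generator hβ]
  exact Submodule.mem_sup_right (Submodule.mem_span_singleton_self β)

/-- Two `Γ₁(𝔫)`-modular points agree if they have the same `Γ₀(𝔫)`-modular point and intersecting
cosets. -/
lemma eq_of_mem_coset {P Q : ModularPoint1 𝔫} (h : P.toModularPoint0 = Q.toModularPoint0)
    {β : KHat2 K} (hP : β ∈ P.coset) (hQ : β ∈ Q.coset) : P = Q :=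
  ModularPoint1.ext (by rw [h]) (by rw [h]) (by
    ext x
    rw [P.mem_coset_iff hP, Q.mem_coset_iff hQ, h])

/-- The relation that `Q` lies above `P`: it is of the form `(M, M + L', β)` for
`P = (L, L', β)`. -/
def Below (P Q : ModularPoint1 𝔫) : Prop :=
  P.toModularPoint0.Below Q.toModularPoint0 ∧ P.coset ⊆ Q.coset

lemma Below.of_le {P Q R : ModularPoint1 𝔫} (h₁ : P.Below Q) (h₂ : P.Below R) (h : Q.L ≤ R.L) :
    Q.Below R := by
  refine ⟨h₁.1.of_le h₂.1 h, fun x hx => ?_⟩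
  obtain ⟨β, hβ⟩ := P.coset_nonempty
  rw [R.mem_coset_iff (h₂.2 hβ)]
  exact h ((Q.mem_coset_iff (h₁.2 hβ) x).mp hx)

lemma Below.eq_of_eq {P Q R : ModularPoint1 𝔫} (h₁ : P.Below Q) (h₂ : P.Below R)
    (h : Q.L = R.L) : Q = R := by
  obtain ⟨β, hβ⟩ := P.coset_nonempty
  exact eq_of_mem_coset (h₁.1.eq_of_eq h₂.1 h) (h₁.2 hβ) (h₂.2 hβ)

lemma Below.exists_between {P Q : ModularPoint1 𝔫} (h : P.Below Q)
    {N : Submodule (𝓞 K) (KHat2 K)} (h₁ : P.L ≤ N) (h₂ : N ≤ Q.L) :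
    ∃ R : ModularPoint1 𝔫, P.Below R ∧ R.L = N := by
  obtain ⟨R, hR, rfl⟩ := h.1.exists_between h₁ h₂
  obtain ⟨β, hβ⟩ := P.coset_nonempty
  have hgen := hR.generator (P.generator hβ)
  refine ⟨⟨R, {x | x - β ∈ R.L}, β, ?_, hgen, rfl⟩, ⟨hR, fun x hx => ?_⟩, rfl⟩
  · rw [hgen]; exact Submodule.mem_sup_right (Submodule.mem_span_singleton_self β)
  · exact h₁ ((P.mem_coset_iff hβ x).mp hx)

lemma mem_scaleInv_coset (hn : 𝔫 ≠ ⊥) (𝔞 : coprimeIdeals 𝔫) (P : ModularPoint1 𝔫) {β : KHat2 K}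
    (hβ : β ∈ P.coset) (hβ' : β ∈ idealSMul (𝔞 : (FractionalIdeal (𝓞 K)⁰ K)ˣ)⁻¹ P.L') :
    β ∈ (P.scaleInv hn 𝔞).coset :=
  ⟨β, hβ, hβ', by rw [sub_self]; exact Submodule.zero_mem _⟩

lemma smul_mem_coset (P : ModularPoint1 𝔫) {β : KHat2 K} (hβ : β ∈ P.coset) {u : 𝓞 K}
    (hu : u - 1 ∈ 𝔫) : u • β ∈ P.coset := by
  have h := (smul_generator_mem_iff P.quot (P.generator hβ) _).mpr hu
  rw [sub_smul, one_smul] at h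
  exact (P.mem_coset_iff hβ _).mpr h

lemma Below.scaleInv (hn : 𝔫 ≠ ⊥) (𝔞 : coprimeIdeals 𝔫) {P Q : ModularPoint1 𝔫}
    (h : P.Below Q) : (P.scaleInv hn 𝔞).Below (Q.scaleInv hn 𝔞) := by
  have h0 := h.1.scale hn (𝔞 : (FractionalIdeal (𝓞 K)⁰ K)ˣ)⁻¹
  refine ⟨h0, ?_⟩
  rintro x ⟨β, hβ, hβ', hx⟩
  exact ⟨β, h.2 hβ, (h0.2.symm ▸ le_sup_right : (P.scaleInv hn 𝔞).L' ≤ (Q.scaleInv hn 𝔞).L') hβ',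
    h0.1 hx⟩

lemma scaleInv_one (hn : 𝔫 ≠ ⊥) (P : ModularPoint1 𝔫) : P.scaleInv hn 1 = P := by
  obtain ⟨β, hβ⟩ := P.coset_nonempty
  refine eq_of_mem_coset ?_ (P.mem_scaleInv_coset hn 1 hβ ?_) hβ
  · change P.toModularPoint0.scale hn 1⁻¹ = _
    rw [inv_one, ModularPoint0.scale_one]
  · rw [Subgroup.coe_one, inv_one, idealSMul_one]
    exact P.mem_of_mem_coset hβ

lemma scaleInv_mul (hn : 𝔫 ≠ ⊥) (𝔞 𝔟 : coprimeIdeals 𝔫) (P : ModularPoint1 𝔫) :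
    P.scaleInv hn (𝔞 * 𝔟) = (P.scaleInv hn 𝔟).scaleInv hn 𝔞 := by
  obtain ⟨β, hβ⟩ := P.coset_nonempty
  -- With `u ≡ v ≡ 1` modulo `𝔫`, the element `uvβ` represents the coset of `P` and lies in all the
  -- scaled modules that occur, so it is a common representative for both sides.
  obtain ⟨u, hu, hua, -⟩ := exists_unit_mod 𝔞
  obtain ⟨v, hv, hvb, -⟩ := exists_unit_mod 𝔟
  have h1 : v • β ∈ idealSMul (𝔟 : (FractionalIdeal (𝓞 K)⁰ K)ˣ)⁻¹ P.L' := by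
    rw [intSMul_eq]
    exact smul_mem_idealSMul hvb (P.mem_of_mem_coset hβ)
  have h2 : u • (v • β) ∈ idealSMul (𝔞 : (FractionalIdeal (𝓞 K)⁰ K)ˣ)⁻¹
      (idealSMul (𝔟 : (FractionalIdeal (𝓞 K)⁰ K)ˣ)⁻¹ P.L') := by
    rw [intSMul_eq]
    exact smul_mem_idealSMul hua h1
  have h3 := P.smul_mem_coset hβ hv
  have h4 := P.mem_scaleInv_coset hn 𝔟 h3 h1
  refine eq_of_mem_coset (β := u • (v • β)) ?_ (mem_scaleInv_coset hn _ _
    (P.smul_mem_coset h3 hu) ?_) (mem_scaleInv_coset hn _ _ (smul_mem_coset _ h4 hu) h2)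
  · change P.toModularPoint0.scale hn _ = (P.toModularPoint0.scale hn _).scale hn _
    rw [← ModularPoint0.scale_mul, Subgroup.coe_mul, mul_inv]
  · rwa [Subgroup.coe_mul, mul_inv, idealSMul_mul]

lemma below_scaleInv (hn : 𝔫 ≠ ⊥) {𝔭 : Ideal (𝓞 K)} (hp : 𝔭.IsPrime) (h0 : 𝔭 ≠ ⊥)
    (hpn : ¬ 𝔭 ∣ 𝔫) (P : ModularPoint1 𝔫) :
    P.Below (P.scaleInv hn (primeToLevel 𝔭 hp h0 hpn)) :=
  ⟨P.below_scale hn hp h0 hpn, fun _ hx => mem_scaleInv_coset hn _ _ hx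
    (le_idealSMul_inv hp h0 hpn _ (P.mem_of_mem_coset hx))⟩

end ModularPoint1

/-- The system of modular points for `Γ₀(𝔫)`. -/
def heckeSystem0 (hn : 𝔫 ≠ ⊥) : HeckeSystem 𝔫 (ModularPoint0 𝔫) where
  lat P := P.L
  isLattice P := P.isLattice
  le := ModularPoint0.Below
  le_refl := ModularPoint0.Below.refl
  le_trans := ModularPoint0.Below.trans
  lat_mono h := h.1
  le_of_lat_le := ModularPoint0.Below.of_le
  eq_of_lat_eq := ModularPoint0.Below.eq_of_eq
  exists_between h := h.exists_between
  scale 𝔞 P := P.scale hn (𝔞 : (FractionalIdeal (𝓞 K)⁰ K)ˣ)⁻¹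
  scale_one P := by rw [Subgroup.coe_one, inv_one, P.scale_one]
  scale_mul 𝔞 𝔟 P := by rw [Subgroup.coe_mul, mul_inv, P.scale_mul]
  lat_scale _ _ := rfl
  scale_mono _ := ModularPoint0.Below.scale hn _
  le_scale := ModularPoint0.below_scale hn
  not_invSMul_le hp h0 hpn := ModularPoint0.Below.not_invSMul_le hn hp h0 hpn

/-- The system of modular points for `Γ₁(𝔫)`. -/
def heckeSystem1 (hn : 𝔫 ≠ ⊥) : HeckeSystem 𝔫 (ModularPoint1 𝔫) where
  lat P := P.L
  isLattice P := P.isLattice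
  le := ModularPoint1.Below
  le_refl _ := ⟨ModularPoint0.Below.refl _, subset_rfl⟩
  le_trans h₁ h₂ := ⟨h₁.1.trans h₂.1, h₁.2.trans h₂.2⟩
  lat_mono h := h.1.1
  le_of_lat_le := ModularPoint1.Below.of_le
  eq_of_lat_eq := ModularPoint1.Below.eq_of_eq
  exists_between h := h.exists_between
  scale 𝔞 P := P.scaleInv hn 𝔞
  scale_one := ModularPoint1.scaleInv_one hn
  scale_mul := ModularPoint1.scaleInv_mul hn
  lat_scale _ _ := rfl
  scale_mono 𝔞 := ModularPoint1.Below.scaleInv hn 𝔞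
  le_scale := ModularPoint1.below_scaleInv hn
  not_invSMul_le hp h0 hpn _ _ h := h.1.not_invSMul_le hn hp h0 hpn

lemma T0_eq (hn : 𝔫 ≠ ⊥) (𝔞 : Ideal (𝓞 K)) : T0 𝔫 𝔞 = (heckeSystem0 hn).T 𝔞 := by
  have h : ∀ P : ModularPoint0 𝔫, heckeSet0 𝔞 P = (heckeSystem0 hn).above 𝔞 P := fun P =>
    Set.ext fun Q => ⟨fun h => ⟨⟨h.1.le, h.2⟩, h.1⟩, fun h => ⟨h.2, h.1.2⟩⟩
  simp only [T0, HeckeSystem.T, h]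

lemma T1_eq (hn : 𝔫 ≠ ⊥) (𝔞 : Ideal (𝓞 K)) : T1 𝔫 𝔞 = (heckeSystem1 hn).T 𝔞 := by
  have h : ∀ P : ModularPoint1 𝔫, heckeSet1 𝔞 P = (heckeSystem1 hn).above 𝔞 P := fun P =>
    Set.ext fun Q => ⟨fun h => ⟨⟨⟨h.1.1.le, h.1.2⟩, h.2⟩, h.1.1⟩,
      fun h => ⟨⟨h.2, h.1.1.2⟩, h.1.2⟩⟩
  simp only [T1, HeckeSystem.T, h]

end Points

/-- The relations between the Hecke operators of a system. -/
theorem HeckeSystem.relations {𝔫 : Ideal (𝓞 K)} {X : Type*} (H : HeckeSystem 𝔫 X) :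
    (H.T ⊤ = 1 ∧ H.S 1 = 1) ∧
      (∀ 𝔞 𝔟 : coprimeIdeals 𝔫, H.S 𝔞 * H.S 𝔟 = H.S (𝔞 * 𝔟) ∧
        H.S (𝔞 * 𝔟) = H.S 𝔟 * H.S 𝔞) ∧
      (∀ (𝔞 : coprimeIdeals 𝔫) (𝔟 : Ideal (𝓞 K)), 𝔟 ≠ ⊥ → H.S 𝔞 * H.T 𝔟 = H.T 𝔟 * H.S 𝔞) ∧
      (∀ 𝔞 𝔟 : Ideal (𝓞 K), 𝔞 ≠ ⊥ → 𝔟 ≠ ⊥ → IsCoprime 𝔞 𝔟 →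
        H.T 𝔞 * H.T 𝔟 = H.T (𝔞 * 𝔟) ∧ H.T (𝔞 * 𝔟) = H.T 𝔟 * H.T 𝔞) ∧
      (∀ 𝔭 : Ideal (𝓞 K), 𝔭.IsPrime → 𝔭 ≠ ⊥ → 𝔭 ∣ 𝔫 → ∀ n : ℕ, 1 ≤ n →
        H.T (𝔭 ^ n) = H.T 𝔭 ^ n) ∧
      (∀ (𝔭 : Ideal (𝓞 K)) (hp : 𝔭.IsPrime) (h0 : 𝔭 ≠ ⊥) (hpn : ¬ 𝔭 ∣ 𝔫) (n : ℕ), 1 ≤ n →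
        H.T (𝔭 ^ n) * H.T 𝔭 = H.T (𝔭 ^ (n + 1)) +
          (Ideal.absNorm 𝔭 : ℚ) •
            (H.T (𝔭 ^ (n - 1)) * H.S (primeToLevel (𝔫 := 𝔫) 𝔭 hp h0 hpn))) := by
  refine ⟨⟨H.T_top, H.S_one⟩, fun 𝔞 𝔟 => ⟨H.S_mul_S 𝔞 𝔟, ?_⟩, fun 𝔞 𝔟 h0 => H.S_mul_T 𝔞 h0,
    fun 𝔞 𝔟 ha hb h => ⟨H.T_mul_T_of_isCoprime ha hb h, ?_⟩,
    fun 𝔭 hp h0 hpn n _ => H.T_pow_of_dvd hp h0 hpn n, fun 𝔭 hp h0 hpn n hn => ?_⟩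
  · rw [mul_comm 𝔞, H.S_mul_S]
  · rw [mul_comm 𝔞, H.T_mul_T_of_isCoprime hb ha h.symm]
  · obtain ⟨k, rfl⟩ := Nat.exists_eq_add_of_le' hn
    exact H.T_pow_mul_T hp h0 hpn k

end LatticeHecke

end

theorem mainTheorem2 {K : Type*} [Field K] [NumberField K] (𝔫 : Ideal (𝓞 K)) (hn : 𝔫 ≠ ⊥) :
    -- the operators on `ℚ 𝓜₀(𝔫)`
    ((T0 𝔫 ⊤ = 1 ∧ S0 (𝔫 := 𝔫) hn 1 = 1) ∧
      (∀ 𝔞 𝔟 : coprimeIdeals 𝔫,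
        S0 hn 𝔞.1 * S0 hn 𝔟.1 = S0 hn (𝔞.1 * 𝔟.1) ∧
        S0 hn (𝔞.1 * 𝔟.1) = S0 hn 𝔟.1 * S0 hn 𝔞.1) ∧
      (∀ (𝔞 : coprimeIdeals 𝔫) (𝔟 : Ideal (𝓞 K)), 𝔟 ≠ ⊥ →
        S0 hn 𝔞.1 * T0 𝔫 𝔟 = T0 𝔫 𝔟 * S0 hn 𝔞.1) ∧
      (∀ 𝔞 𝔟 : Ideal (𝓞 K), 𝔞 ≠ ⊥ → 𝔟 ≠ ⊥ → IsCoprime 𝔞 𝔟 →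
        T0 𝔫 𝔞 * T0 𝔫 𝔟 = T0 𝔫 (𝔞 * 𝔟) ∧ T0 𝔫 (𝔞 * 𝔟) = T0 𝔫 𝔟 * T0 𝔫 𝔞) ∧
      (∀ 𝔭 : Ideal (𝓞 K), 𝔭.IsPrime → 𝔭 ≠ ⊥ → 𝔭 ∣ 𝔫 → ∀ n : ℕ, 1 ≤ n →
        T0 𝔫 (𝔭 ^ n) = T0 𝔫 𝔭 ^ n) ∧
      (∀ (𝔭 : Ideal (𝓞 K)) (hp : 𝔭.IsPrime) (h0 : 𝔭 ≠ ⊥) (hpn : ¬ 𝔭 ∣ 𝔫) (n : ℕ), 1 ≤ n →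
        T0 𝔫 (𝔭 ^ n) * T0 𝔫 𝔭 = T0 𝔫 (𝔭 ^ (n + 1)) +
          (Ideal.absNorm 𝔭 : ℚ) •
            (T0 𝔫 (𝔭 ^ (n - 1)) * S0 hn (primeToLevel (𝔫 := 𝔫) 𝔭 hp h0 hpn).1))) ∧
    -- the operators on `ℚ 𝓜₁(𝔫)`
    ((T1 𝔫 ⊤ = 1 ∧ S1 (𝔫 := 𝔫) hn 1 = 1) ∧
      (∀ 𝔞 𝔟 : coprimeIdeals 𝔫,
        S1 hn 𝔞 * S1 hn 𝔟 = S1 hn (𝔞 * 𝔟) ∧ S1 hn (𝔞 * 𝔟) = S1 hn 𝔟 * S1 hn 𝔞) ∧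
      (∀ (𝔞 : coprimeIdeals 𝔫) (𝔟 : Ideal (𝓞 K)), 𝔟 ≠ ⊥ →
        S1 hn 𝔞 * T1 𝔫 𝔟 = T1 𝔫 𝔟 * S1 hn 𝔞) ∧
      (∀ 𝔞 𝔟 : Ideal (𝓞 K), 𝔞 ≠ ⊥ → 𝔟 ≠ ⊥ → IsCoprime 𝔞 𝔟 →
        T1 𝔫 𝔞 * T1 𝔫 𝔟 = T1 𝔫 (𝔞 * 𝔟) ∧ T1 𝔫 (𝔞 * 𝔟) = T1 𝔫 𝔟 * T1 𝔫 𝔞) ∧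
      (∀ 𝔭 : Ideal (𝓞 K), 𝔭.IsPrime → 𝔭 ≠ ⊥ → 𝔭 ∣ 𝔫 → ∀ n : ℕ, 1 ≤ n →
        T1 𝔫 (𝔭 ^ n) = T1 𝔫 𝔭 ^ n) ∧
      (∀ (𝔭 : Ideal (𝓞 K)) (hp : 𝔭.IsPrime) (h0 : 𝔭 ≠ ⊥) (hpn : ¬ 𝔭 ∣ 𝔫) (n : ℕ), 1 ≤ n →
        T1 𝔫 (𝔭 ^ n) * T1 𝔫 𝔭 = T1 𝔫 (𝔭 ^ (n + 1)) +
          (Ideal.absNorm 𝔭 : ℚ) •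
            (T1 𝔫 (𝔭 ^ (n - 1)) * S1 hn (primeToLevel 𝔭 hp h0 hpn)))) := by
  -- Only the operators `T0` and `T1` need rewriting: `S0` and `S1` agree definitionally with the
  -- operators `S` of the two systems.
  simp only [T0_eq hn, T1_eq hn]
  exact ⟨(heckeSystem0 hn).relations, (heckeSystem1 hn).relations⟩
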